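/- Let $\{X_{n,i} : n \in \mathbb{N},\ 1 \le i \le n\}$ be a triangular array of real-valued random variables on a probability space. Suppose that each row $X_{n,1},\dots,X_{n,n}$ is strictly stationary and that $\mathbb{E}[X_{n,i}] = 0$ for all $n, i$. For $j \ge 1$ let $$\alpha_n(j) = \sup_{k}\ \sup_{A \in \sigma(X_{n,r} :\, r \le k),\ B \in \sigma(X_{n,r} :\, r \ge k+j)} \left| \mathbb{P}(A\cap B) - \mathbb{P}(A)\mathbb{P}(B) \right|$$ be the $\alpha$-mixing coefficients of the $n$-th row. Suppose that for some $\delta > 0$ and constants $K, C > 0$, for all $n$ and all $1 \le i \le n$, $$\mathbb{E}\left[|X_{n,i}|^{4+2\delta}\right] \le K, \qquad \sum_{j=1}^{n-1} \alpha_n(j)^{\frac{\delta}{2+\delta}} \le C .$$ Suppose also that there is $\sigma^2 > 0$ with $\mathrm{Var}(X_{n,i}) = \sigma^2$ for all $n, i$, and that there is $\tau^2 > 0$ such that, as $n \to \infty$, $$\mathrm{Var}(X_{n,1}) + 2\sum_{i=1}^{n-1} \mathrm{Cov}(X_{n,1}, X_{n,1+i}) \to \tau^2 .$$ Let $(b_n)$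 be a sequence of real numbers with $b_n \to \infty$ and $b_n = o(\sqrt{n})$. For $x = (x_1,\dots,x_n)\in\mathbb{R}^n$ with mean $\bar x = \frac1n\sum_{i=1}^n x_i$ let $$\hat\tau_n^2(x) = \frac1n \sum_{i=1}^n (x_i - \bar x)^2 + \frac2n \sum_{1 \le i \le b_n}\ \sum_{j=1}^{n-i} (x_j - \bar x)(x_{j+i} - \bar x),$$ where $i$ runs over integers and the inner sum is empty if $i \ge n$. Then: (i) $\hat\tau_n^2(X_{n,1},\dots,X_{n,n}) \to \tau^2$ in probability as $n \to \infty$; (ii) if, for each $n$, $\Pi_n$ is a uniformly distributed random permutation of $\{1,\dots,n\}$, independent of the row $(X_{n,1},\dots,X_{n,n})$, then $\hat\tau_n^2(X_{n,\Pi_n(1)},\dots,X_{n,\Pi_n(n)}) \to \sigma^2$ in probability as $n \to \infty$. -/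

import Mathlib

open MeasureTheory ProbabilityTheory Filter Topology Asymptotics

/-- The random permutations of a row take values in a finite set, with the discrete σ-algebra. -/
instance permFinMeasurableSpace (n : ℕ) : MeasurableSpace (Equiv.Perm (Fin n)) := ⊤

instance permFinDiscreteMeasurableSpace (n : ℕ) :
    DiscreteMeasurableSpace (Equiv.Perm (Fin n)) := ⟨fun _ => trivial⟩

section Rows

variable {Ω : Type*} [MeasurableSpace Ω]

/-- Strict stationarity of a row `X 0, …, X (n - 1)`: any `k` consecutive entries have
the same joint law as the first `k` entries. -/
def IsStrictlyStationaryRow (P : Measure Ω) {n : ℕ} (X : Fin n → Ω → ℝ) : Prop :=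
  ∀ (k h : ℕ) (hkh : k + h ≤ n),
    IdentDistrib
      (fun ω (i : Fin k) => X ⟨i, lt_of_lt_of_le i.isLt (by omega)⟩ ω)
      (fun ω (i : Fin k) => X ⟨i + h, lt_of_lt_of_le (Nat.add_lt_add_right i.isLt h) hkh⟩ ω)
      P P

/-- The σ-algebra generated by the entries of the row with index at most `k`. -/
abbrev rowPast {n : ℕ} (X : Fin n → Ω → ℝ) (k : ℕ) : MeasurableSpace Ω :=
  ⨆ i : {i : Fin n // (i : ℕ) ≤ k}, MeasurableSpace.comap (X i) inferInstance

/-- The σ-algebra generated by the entries of the row with index at least `k`. -/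
abbrev rowFuture {n : ℕ} (X : Fin n → Ω → ℝ) (k : ℕ) : MeasurableSpace Ω :=
  ⨆ i : {i : Fin n // k ≤ (i : ℕ)}, MeasurableSpace.comap (X i) inferInstance

/-- Rosenblatt's α-mixing coefficient of a row at lag `j`: the supremum of
`|P (A ∩ B) - P A * P B|` over all indices `k`, all `A` in the σ-algebra of the entries with
index at most `k` and all `B` in the σ-algebra of the entries with index at least `k + j`. -/
noncomputable def rowAlpha (P : Measure Ω) {n : ℕ} (X : Fin n → Ω → ℝ) (j : ℕ) : ℝ :=
  sSup {r : ℝ | ∃ (k : ℕ) (A B : Set Ω),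
    MeasurableSet[rowPast X k] A ∧ MeasurableSet[rowFuture X (k + j)] B ∧
    r = |P.real (A ∩ B) - P.real A * P.real B|}

/-- `Var(X₁) + 2 ∑_{i=1}^{n-1} Cov(X₁, X_{1+i})` for a row `X₁, …, X_n`
(the entry `X₁` has index `0`; the empty row gets the value `0`). -/
noncomputable def rowLongRunVariance (P : Measure Ω) {n : ℕ} (X : Fin n → Ω → ℝ) : ℝ :=
  if h : 0 < n then
    Var[X ⟨0, h⟩; P] +
      2 * ∑ i : Fin (n - 1), cov[X ⟨0, h⟩, X ⟨1 + i, by have := i.isLt; omega⟩; P]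
  else 0

end Rows

/-- The sample mean. -/
noncomputable def sampleMean {n : ℕ} (x : Fin n → ℝ) : ℝ :=
  (1 / (n : ℝ)) * ∑ i, x i

/-- The truncated autocovariance estimator
`(1/n) ∑_{i=1}^n (x_i - x̄)² + (2/n) ∑_{i=1}^{b} ∑_{j=1}^{n-i} (x_j - x̄) (x_{j+i} - x̄)`.
The truncation `b` is real, the sum over `i` is over the integers `1 ≤ i ≤ b`,
and the sum over `j` is empty if `n ≤ i`. -/
noncomputable def tauHatSq {n : ℕ} (b : ℝ) (x : Fin n → ℝ) : ℝ :=
  (1 / (n : ℝ)) * ∑ i, (x i - sampleMean x) ^ 2 +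
    (2 / (n : ℝ)) * ∑ i ∈ Finset.Icc 1 ⌊b⌋₊, ∑ j : Fin (n - i),
      (x ⟨j, by have := j.isLt; omega⟩ - sampleMean x) *
        (x ⟨j + i, by have := j.isLt; omega⟩ - sampleMean x)

/-! Both limits are proved in `L¹`, and convergence in probability follows.

The engine is Davydov's inequality (`abs_integral_mul_sub_le_rpow`): a covariance of products of `a`
and `b` entries with `q`-th moments is at most a constant times `α ^ (1 - (a + b) / q)`. For `q = 4
+ 2δ`, four factors give exactly the summable power `δ / (2 + δ)`, and two factors give a strictly
larger power. `IsMomentMixing` keeps only these consequences for mixed moments.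

For (i), put `B = ⌊b⌋₊`. Up to centering, the estimator is an average of lagged products. The
covariance of `x_j x_{j+i}` with `x_l x_{l+k}`, `j ≤ l`, decays in `l - (j + i)` when the pairs are
separated and in `l - j` when they interlace. For fixed `i, j, k` its sum over `l` is therefore
bounded, so the variance is `O((B + 1)² / n)`, which vanishes because `b = o(√n)`. The squared
sample mean is `O(1 / n)` in expectation, so centering costs `O((B + 1) / n)`. The bias comes from
the weights `1 - i / n` and from the lags beyond `B`. The tail of the autocovariances is small
uniformly in `n` thanks to the spare power of the two-factor case.

For (ii), the sample mean and the sample variance do not change under permutation, and the sample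
variance is the estimator with truncation `0`, covered by the bounds for (i). What remains is a sum
of lagged products of exchangeable deviations that add up to zero. Summing over one free index shows
that mixed moments of four distinct deviations are `O(1 / n)` (`abs_integral_four_le_of_distinct`),
while a coincidence of indices removes one summation. The second moment of the sum is thus `O(B²
n)`, and after division by `n` its `L¹` norm is `O((B + 1) / √n)`. Mixing plays no role in this
part. -/

/-! ### Covariance inequalities under α-mixing. -/

section CovarianceInequality

variable {Ω : Type*} {m₁ m₂ m0 : MeasurableSpace Ω} {P : Measure Ω} [IsProbabilityMeasure P]

/-- A covariance with a bounded `m₁`-measurable variable is controlled by the covariances with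
indicators of sets of `m₁`. -/
theorem abs_integral_mul_sub_le_of_forall_setIntegral (hm : m₁ ≤ m0) {X Y : Ω → ℝ} {M c : ℝ}
    (hX : StronglyMeasurable[m₁] X) (hXM : ∀ ω, |X ω| ≤ M) (hY : Integrable Y P)
    (h : ∀ A, MeasurableSet[m₁] A → |∫ ω in A, Y ω ∂P - P.real A * ∫ ω, Y ω ∂P| ≤ c) :
    |∫ ω, X ω * Y ω ∂P - (∫ ω, X ω ∂P) * ∫ ω, Y ω ∂P| ≤ M * (2 * c) := by
  have hM : 0 ≤ M := by
    obtain ⟨ω⟩ : Nonempty Ω := nonempty_of_isProbabilityMeasure P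
    exact (abs_nonneg _).trans (hXM ω)
  set e := ∫ ω, Y ω ∂P
  set Z : Ω → ℝ := fun ω => (P[Y|m₁]) ω - e with hZ
  have hZi : Integrable Z P := integrable_condExp.sub (integrable_const _)
  have hZm : StronglyMeasurable[m₁] Z := stronglyMeasurable_condExp.sub stronglyMeasurable_const
  have hXi : Integrable X P :=
    Integrable.of_bound (hX.mono hm).aestronglyMeasurable M (ae_of_all _ fun ω => hXM ω)
  have hXY : Integrable (X * Y) P :=
    hY.bdd_mul (c := M) (hX.mono hm).aestronglyMeasurable (ae_of_all _ fun ω => hXM ω)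
  have hXZ : Integrable (fun ω => X ω * (P[Y|m₁]) ω) P :=
    integrable_condExp.bdd_mul (c := M) (hX.mono hm).aestronglyMeasurable
      (ae_of_all _ fun ω => hXM ω)
  have h1 : ∫ ω, X ω * Y ω ∂P = ∫ ω, X ω * (P[Y|m₁]) ω ∂P := by
    rw [← integral_condExp hm (f := fun ω => X ω * Y ω)]
    exact integral_congr_ae (condExp_mul_of_stronglyMeasurable_left hX hXY hY)
  have h2 : ∫ ω, X ω * Y ω ∂P - (∫ ω, X ω ∂P) * e = ∫ ω, X ω * Z ω ∂P := by
    simp only [hZ, mul_sub]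
    rw [integral_sub hXZ (hXi.mul_const _), integral_mul_const, h1]
  have hset : ∀ A, MeasurableSet[m₁] A → |∫ ω in A, Z ω ∂P| ≤ c := by
    intro A hA
    have : ∫ ω in A, Z ω ∂P = ∫ ω in A, Y ω ∂P - P.real A * e := by
      simp only [hZ]
      rw [integral_sub integrable_condExp.integrableOn (integrable_const _),
        setIntegral_condExp hm hY hA, setIntegral_const, smul_eq_mul]
    rw [this]
    exact h A hA
  -- The centered conditional expectation `Z` is `m₁`-measurable, so the sets where it is
  -- nonnegative and negative are admissible in `hset`; each contributes `c` to the `L¹` norm of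
  -- `Z`.
  have hA : MeasurableSet[m₁] {ω | 0 ≤ Z ω} := hZm.measurable measurableSet_Ici
  have h3 : ∫ ω, |Z ω| ∂P ≤ 2 * c := by
    rw [← integral_add_compl (hm _ hA) hZi.abs]
    have e1 : ∫ ω in {ω | 0 ≤ Z ω}, |Z ω| ∂P = ∫ ω in {ω | 0 ≤ Z ω}, Z ω ∂P :=
      setIntegral_congr_fun (hm _ hA) fun ω hω => abs_of_nonneg hω
    have e2 : ∫ ω in {ω | 0 ≤ Z ω}ᶜ, |Z ω| ∂P = - ∫ ω in {ω | 0 ≤ Z ω}ᶜ, Z ω ∂P := by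
      rw [← integral_neg]
      refine setIntegral_congr_fun (hm _ hA.compl) fun ω hω => abs_of_nonpos ?_
      exact (not_le.1 (show ¬ (0 ≤ Z ω) from hω)).le
    rw [e1, e2]
    have := (abs_le.1 (hset _ hA)).2
    have := (abs_le.1 (hset _ hA.compl)).1
    linarith
  rw [h2]
  calc |∫ ω, X ω * Z ω ∂P| ≤ ∫ ω, |X ω * Z ω| ∂P := abs_integral_le_integral_abs
    _ ≤ ∫ ω, M * |Z ω| ∂P := by
        refine integral_mono_of_nonneg (ae_of_all _ fun ω => abs_nonneg _)
          (hZi.abs.const_mul M) (ae_of_all _ fun ω => ?_)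
        simp only [abs_mul]
        exact mul_le_mul_of_nonneg_right (hXM ω) (abs_nonneg _)
    _ = M * ∫ ω, |Z ω| ∂P := integral_const_mul _ _
    _ ≤ M * (2 * c) := mul_le_mul_of_nonneg_left h3 hM

/-- The covariance inequality for bounded variables under `α`-mixing. -/
theorem abs_integral_mul_sub_le_of_bounded (hm₁ : m₁ ≤ m0) (hm₂ : m₂ ≤ m0) {X Y : Ω → ℝ}
    {M N α : ℝ} (hX : StronglyMeasurable[m₁] X) (hY : StronglyMeasurable[m₂] Y)
    (hXM : ∀ ω, |X ω| ≤ M) (hYN : ∀ ω, |Y ω| ≤ N)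
    (hα : ∀ A B, MeasurableSet[m₁] A → MeasurableSet[m₂] B →
      |P.real (A ∩ B) - P.real A * P.real B| ≤ α) :
    |∫ ω, X ω * Y ω ∂P - (∫ ω, X ω ∂P) * ∫ ω, Y ω ∂P| ≤ 4 * α * M * N := by
  have hYi : Integrable Y P :=
    Integrable.of_bound (hY.mono hm₂).aestronglyMeasurable N (ae_of_all _ fun ω => hYN ω)
  have key : ∀ A, MeasurableSet[m₁] A →
      |∫ ω in A, Y ω ∂P - P.real A * ∫ ω, Y ω ∂P| ≤ N * (2 * α) := by
    intro A hA
    have hA' := hm₁ _ hA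
    have hi : Integrable (A.indicator fun _ => (1 : ℝ)) P :=
      (integrable_const (1 : ℝ)).indicator hA'
    have := abs_integral_mul_sub_le_of_forall_setIntegral (P := P) hm₂ hY hYN hi (c := α)
      (fun B hB => by
        rw [setIntegral_indicator hA', setIntegral_const, integral_indicator hA',
          setIntegral_const, Set.inter_comm, smul_eq_mul, smul_eq_mul, mul_one, mul_one,
          mul_comm (P.real B)]
        exact hα A B hA hB)
    rw [integral_indicator hA', setIntegral_const, smul_eq_mul, mul_one] at this
    have e : ∫ ω, Y ω * A.indicator (fun _ => (1 : ℝ)) ω ∂P = ∫ ω in A, Y ω ∂P := by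
      rw [← integral_indicator hA']
      refine integral_congr_ae (ae_of_all _ fun ω => ?_)
      by_cases h : ω ∈ A <;> simp [h]
    rwa [e, mul_comm (∫ ω, Y ω ∂P)] at this
  -- The same reduction to indicators is applied twice, first to `Y` against an indicator and now to
  -- `X` against `Y`. Each use contributes a factor 2, hence the 4.
  have := abs_integral_mul_sub_le_of_forall_setIntegral (P := P) hm₁ hX hXM hYi key
  linarith

/-- Truncation step: a covariance is bounded in terms of a truncation level `L`. -/
theorem abs_integral_mul_sub_le_of_level (hm₁ : m₁ ≤ m0) (hm₂ : m₂ ≤ m0) {X Y D : Ω → ℝ}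
    {M α q L : ℝ} {a b : ℕ} (hX : StronglyMeasurable[m₁] X) (hY : StronglyMeasurable[m₂] Y)
    (hD0 : ∀ ω, 0 ≤ D ω) (hXD : ∀ ω, |X ω| ≤ D ω ^ a) (hYD : ∀ ω, |Y ω| ≤ D ω ^ b)
    (hq : (a + b : ℝ) < q) (hDi : Integrable (fun ω => D ω ^ q) P)
    (hDM : ∫ ω, D ω ^ q ∂P ≤ M)
    (hα : ∀ A B, MeasurableSet[m₁] A → MeasurableSet[m₂] B →
      |P.real (A ∩ B) - P.real A * P.real B| ≤ α) (hL : 1 ≤ L) :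
    |∫ ω, X ω * Y ω ∂P - (∫ ω, X ω ∂P) * ∫ ω, Y ω ∂P| ≤
      4 * α * L ^ (a + b) + 2 * (M + M * (1 + M)) * L ^ ((a + b : ℝ) - q) := by
  have hL0 : 0 < L := by linarith
  -- Above level `L ≥ 1`, low powers are traded for the `q`-th power at a gain of a negative power
  -- of `L`.
  have hpt : ∀ k : ℕ, (k : ℝ) ≤ a + b → ∀ d : ℝ, L < d → d ^ k ≤ d ^ q * L ^ ((a + b : ℝ) - q) := by
    intro k hk d hd
    have hd0 : 0 < d := by linarith
    have h1 : d ^ k ≤ d ^ ((a : ℝ) + b) := by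
      rw [← Real.rpow_natCast]
      exact Real.rpow_le_rpow_of_exponent_le (by linarith) hk
    have h2 : d ^ ((a : ℝ) + b) = d ^ q * d ^ ((a + b : ℝ) - q) := by
      rw [← Real.rpow_add hd0]; congr 1; ring
    have h3 : d ^ ((a + b : ℝ) - q) ≤ L ^ ((a + b : ℝ) - q) :=
      Real.rpow_le_rpow_of_nonpos hL0 hd.le (by linarith)
    rw [h2] at h1
    exact h1.trans (mul_le_mul_of_nonneg_left h3 (Real.rpow_nonneg hd0.le _))
  have hone : ∀ k : ℕ, (k : ℝ) ≤ a + b → ∀ d : ℝ, 0 ≤ d → d ^ k ≤ 1 + d ^ q := by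
    intro k hk d hd
    rcases le_total d 1 with h | h
    · have := pow_le_one₀ hd h (n := k)
      have := Real.rpow_nonneg hd q
      linarith
    · have : d ^ k ≤ d ^ q := by
        rw [← Real.rpow_natCast]
        exact Real.rpow_le_rpow_of_exponent_le h (by linarith)
      linarith
  set ℓ := L ^ ((a + b : ℝ) - q) with hℓ
  have hℓ0 : 0 ≤ ℓ := Real.rpow_nonneg hL0.le _
  have hm0 : 0 ≤ ∫ ω, D ω ^ q ∂P := integral_nonneg fun ω => Real.rpow_nonneg (hD0 ω) q
  have hM0 : 0 ≤ M := hm0.trans hDM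
  have ha0 : (0 : ℝ) ≤ a := a.cast_nonneg
  have hb0 : (0 : ℝ) ≤ b := b.cast_nonneg
  have hXm := (hX.mono hm₁)
  have hYm := (hY.mono hm₂)
  set X' : Ω → ℝ := fun ω => if |X ω| ≤ L ^ a then X ω else 0 with hX'
  set Y' : Ω → ℝ := fun ω => if |Y ω| ≤ L ^ b then Y ω else 0 with hY'
  have hX'm : StronglyMeasurable[m₁] X' := by
    refine StronglyMeasurable.ite ?_ hX stronglyMeasurable_const
    exact hX.measurable (measurableSet_le (measurable_id.abs) measurable_const :
      MeasurableSet {x : ℝ | |x| ≤ L ^ a})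
  have hY'm : StronglyMeasurable[m₂] Y' := by
    refine StronglyMeasurable.ite ?_ hY stronglyMeasurable_const
    exact hY.measurable (measurableSet_le (measurable_id.abs) measurable_const :
      MeasurableSet {x : ℝ | |x| ≤ L ^ b})
  have hX'b : ∀ ω, |X' ω| ≤ L ^ a := by
    intro ω
    simp only [hX']
    split_ifs with h
    · exact h
    · simpa using pow_nonneg hL0.le a
  have hY'b : ∀ ω, |Y' ω| ≤ L ^ b := by
    intro ω
    simp only [hY']
    split_ifs with h
    · exact h
    · simpa using pow_nonneg hL0.le b
  have hX'X : ∀ ω, |X' ω| ≤ D ω ^ a := by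
    intro ω
    simp only [hX']
    split_ifs with h
    · exact hXD ω
    · simpa using pow_nonneg (hD0 ω) a
  have hY'Y : ∀ ω, |Y' ω| ≤ D ω ^ b := by
    intro ω
    simp only [hY']
    split_ifs with h
    · exact hYD ω
    · simpa using pow_nonneg (hD0 ω) b
  -- Where `X` is cut off, `L ^ a < |X| ≤ D ^ a` forces `L < D`, so the remainder lives where `hpt`
  -- applies.
  have hXr : ∀ ω, |X ω - X' ω| ≤ D ω ^ a ∧ (X ω - X' ω = 0 ∨ L < D ω) := by
    intro ω
    simp only [hX']
    split_ifs with h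
    · simpa using pow_nonneg (hD0 ω) a
    · refine ⟨by simpa using hXD ω, Or.inr ?_⟩
      exact lt_of_pow_lt_pow_left₀ a (hD0 ω) ((not_le.1 h).trans_le (hXD ω))
  have hYr : ∀ ω, |Y ω - Y' ω| ≤ D ω ^ b ∧ (Y ω - Y' ω = 0 ∨ L < D ω) := by
    intro ω
    simp only [hY']
    split_ifs with h
    · simpa using pow_nonneg (hD0 ω) b
    · refine ⟨by simpa using hYD ω, Or.inr ?_⟩
      exact lt_of_pow_lt_pow_left₀ b (hD0 ω) ((not_le.1 h).trans_le (hYD ω))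
  have hint : ∀ (k : ℕ), (k : ℝ) ≤ a + b → ∀ f : Ω → ℝ, StronglyMeasurable f →
      (∀ ω, |f ω| ≤ D ω ^ k) → Integrable f P := by
    intro k hk f hf hb
    refine ((integrable_const (1 : ℝ)).add hDi).mono' hf.aestronglyMeasurable
      (ae_of_all _ fun ω => ?_)
    exact (hb ω).trans (hone k hk _ (hD0 ω))
  have hbig : ∀ (k : ℕ), (k : ℝ) ≤ a + b → ∀ f : Ω → ℝ,
      (∀ ω, |f ω| ≤ D ω ^ k ∧ (f ω = 0 ∨ L < D ω)) → |∫ ω, f ω ∂P| ≤ M * ℓ := by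
    intro k hk f hb
    calc |∫ ω, f ω ∂P| ≤ ∫ ω, |f ω| ∂P := abs_integral_le_integral_abs
      _ ≤ ∫ ω, D ω ^ q * ℓ ∂P := by
          refine integral_mono_of_nonneg (ae_of_all _ fun ω => abs_nonneg _)
            (hDi.mul_const _) (ae_of_all _ fun ω => ?_)
          rcases (hb ω).2 with h | h
          · simpa [h] using mul_nonneg (Real.rpow_nonneg (hD0 ω) q) hℓ0
          · exact (hb ω).1.trans (hpt k hk _ h)
      _ = (∫ ω, D ω ^ q ∂P) * ℓ := integral_mul_const _ _
      _ ≤ M * ℓ := mul_le_mul_of_nonneg_right hDM hℓ0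
  have hsmall : ∀ (k : ℕ), (k : ℝ) ≤ a + b → ∀ f : Ω → ℝ,
      (∀ ω, |f ω| ≤ D ω ^ k) → |∫ ω, f ω ∂P| ≤ 1 + M := by
    intro k hk f hb
    calc |∫ ω, f ω ∂P| ≤ ∫ ω, |f ω| ∂P := abs_integral_le_integral_abs
      _ ≤ ∫ ω, (1 + D ω ^ q) ∂P :=
          integral_mono_of_nonneg (ae_of_all _ fun ω => abs_nonneg _)
            ((integrable_const (1 : ℝ)).add hDi)
            (ae_of_all _ fun ω => (hb ω).trans (hone k hk _ (hD0 ω)))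
      _ = 1 + ∫ ω, D ω ^ q ∂P := by rw [integral_add (integrable_const _) hDi]; simp
      _ ≤ 1 + M := by linarith
  have hmul : ∀ {f g : Ω → ℝ}, (∀ ω, |f ω| ≤ D ω ^ a) → (∀ ω, |g ω| ≤ D ω ^ b) →
      ∀ ω, |f ω * g ω| ≤ D ω ^ (a + b) := by
    intro f g hf hg ω
    rw [abs_mul, pow_add]
    exact mul_le_mul (hf ω) (hg ω) (abs_nonneg _) (pow_nonneg (hD0 ω) _)
  have hak : (a : ℝ) ≤ a + b := by linarith
  have hbk : (b : ℝ) ≤ a + b := by linarith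
  have habk : ((a + b : ℕ) : ℝ) ≤ a + b := by push_cast; rfl
  have hX'm0 := hX'm.mono hm₁
  have hY'm0 := hY'm.mono hm₂
  have iX := hint a hak X hXm hXD
  have iX' := hint a hak X' hX'm0 hX'X
  have iY := hint b hbk Y hYm hYD
  have iY' := hint b hbk Y' hY'm0 hY'Y
  have i1 := hint _ habk _ (hXm.mul hYm) (hmul hXD hYD)
  have i2 := hint _ habk _ (hX'm0.mul hYm) (hmul hX'X hYD)
  have i3 := hint _ habk _ (hX'm0.mul hY'm0) (hmul hX'X hY'Y)
  have c1 := abs_integral_mul_sub_le_of_bounded (P := P) hm₁ hm₂ hX'm hY'm hX'b hY'b hα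
  have c2 : |∫ ω, (X ω - X' ω) * Y ω ∂P| ≤ M * ℓ := by
    refine hbig _ habk _ fun ω => ⟨hmul (fun ω => (hXr ω).1) hYD ω, ?_⟩
    rcases (hXr ω).2 with h | h
    · left; rw [h, zero_mul]
    · exact Or.inr h
  have c3 : |∫ ω, X' ω * (Y ω - Y' ω) ∂P| ≤ M * ℓ := by
    refine hbig _ habk _ fun ω => ⟨hmul hX'X (fun ω => (hYr ω).1) ω, ?_⟩
    rcases (hYr ω).2 with h | h
    · left; rw [h, mul_zero]
    · exact Or.inr h
  have c4 : |∫ ω, (X ω - X' ω) ∂P| ≤ M * ℓ := hbig _ hak _ hXr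
  have c5 : |∫ ω, (Y ω - Y' ω) ∂P| ≤ M * ℓ := hbig _ hbk _ hYr
  have c6 : |∫ ω, X' ω ∂P| ≤ 1 + M := hsmall _ hak _ hX'X
  have c7 : |∫ ω, Y ω ∂P| ≤ 1 + M := hsmall _ hbk _ hYD
  have e2 : ∫ ω, (X ω - X' ω) * Y ω ∂P = ∫ ω, X ω * Y ω ∂P - ∫ ω, X' ω * Y ω ∂P := by
    simp only [sub_mul]; exact integral_sub i1 i2
  have e3 : ∫ ω, X' ω * (Y ω - Y' ω) ∂P = ∫ ω, X' ω * Y ω ∂P - ∫ ω, X' ω * Y' ω ∂P := by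
    simp only [mul_sub]; exact integral_sub i2 i3
  have e4 : ∫ ω, (X ω - X' ω) ∂P = ∫ ω, X ω ∂P - ∫ ω, X' ω ∂P := integral_sub iX iX'
  have e5 : ∫ ω, (Y ω - Y' ω) ∂P = ∫ ω, Y ω ∂P - ∫ ω, Y' ω ∂P := integral_sub iY iY'
  have p1 : |(∫ ω, (X ω - X' ω) ∂P) * ∫ ω, Y ω ∂P| ≤ M * ℓ * (1 + M) := by
    rw [abs_mul]; exact mul_le_mul c4 c7 (abs_nonneg _) (by positivity)
  have p2 : |(∫ ω, X' ω ∂P) * ∫ ω, (Y ω - Y' ω) ∂P| ≤ (1 + M) * (M * ℓ) := by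
    rw [abs_mul]; exact mul_le_mul c6 c5 (abs_nonneg _) (by positivity)
  -- Truncating one factor at a time leaves four errors: two in the mean of the product, each at
  -- most `M * ℓ`, and two in the product of the means, each at most `M * ℓ * (1 + M)`.
  have dec : ∫ ω, X ω * Y ω ∂P - (∫ ω, X ω ∂P) * ∫ ω, Y ω ∂P =
      (∫ ω, X' ω * Y' ω ∂P - (∫ ω, X' ω ∂P) * ∫ ω, Y' ω ∂P) +
      ∫ ω, (X ω - X' ω) * Y ω ∂P + ∫ ω, X' ω * (Y ω - Y' ω) ∂P -
      (∫ ω, (X ω - X' ω) ∂P) * ∫ ω, Y ω ∂P - (∫ ω, X' ω ∂P) * ∫ ω, (Y ω - Y' ω) ∂P := by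
    rw [e2, e3, e4, e5]; ring
  rw [dec, pow_add]
  rw [abs_le] at *
  constructor <;> linarith

/-- Davydov's covariance inequality, for variables dominated by powers of one variable `D`
with a finite moment of order `q`. -/
theorem abs_integral_mul_sub_le_rpow (hm₁ : m₁ ≤ m0) (hm₂ : m₂ ≤ m0) {X Y D : Ω → ℝ}
    {M α q : ℝ} (a b : ℕ) (hX : StronglyMeasurable[m₁] X) (hY : StronglyMeasurable[m₂] Y)
    (hD0 : ∀ ω, 0 ≤ D ω) (hXD : ∀ ω, |X ω| ≤ D ω ^ a) (hYD : ∀ ω, |Y ω| ≤ D ω ^ b)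
    (hq : (a + b : ℝ) < q) (hDi : Integrable (fun ω => D ω ^ q) P)
    (hDM : ∫ ω, D ω ^ q ∂P ≤ M) (hα0 : 0 ≤ α) (hα1 : α ≤ 1)
    (hα : ∀ A B, MeasurableSet[m₁] A → MeasurableSet[m₂] B →
      |P.real (A ∩ B) - P.real A * P.real B| ≤ α) :
    |∫ ω, X ω * Y ω ∂P - (∫ ω, X ω ∂P) * ∫ ω, Y ω ∂P| ≤
      (4 + 2 * (M + M * (1 + M))) * α ^ (1 - (a + b : ℝ) / q) := by
  have hlev := fun (L : ℝ) (hL : 1 ≤ L) =>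
    abs_integral_mul_sub_le_of_level (P := P) (L := L) hm₁ hm₂ hX hY hD0 hXD hYD hq hDi hDM hα hL
  have hq0 : 0 < q := lt_of_le_of_lt (by positivity) hq
  rcases hα0.eq_or_lt with h0 | h0
  -- For `α = 0` the optimal level is infinite, so the bound is obtained by letting `L → ∞`.
  · have hexp : (1 - (a + b : ℝ) / q) ≠ 0 := by
      have : (a + b : ℝ) / q < 1 := (div_lt_one hq0).2 hq
      linarith
    rw [← h0, Real.zero_rpow hexp, mul_zero]
    have hlim : Tendsto (fun L : ℝ => 2 * (M + M * (1 + M)) * L ^ ((a + b : ℝ) - q)) atTop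
        (𝓝 (2 * (M + M * (1 + M)) * 0)) := by
      refine Tendsto.const_mul _ ?_
      have := tendsto_rpow_neg_atTop (y := q - (a + b : ℝ)) (by linarith)
      simpa using this
    rw [mul_zero] at hlim
    refine ge_of_tendsto hlim ?_
    filter_upwards [eventually_ge_atTop 1] with L hL
    have := hlev L hL
    rwa [← h0, mul_zero, zero_mul, zero_add] at this
  -- The level `L = α ^ (-1 / q)` balances `α * L ^ (a + b)` against `L ^ (a + b - q)`.
  · have hL : 1 ≤ α ^ (-(1 / q)) :=
      Real.one_le_rpow_of_pos_of_le_one_of_nonpos h0 hα1 (by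
        have : 0 < 1 / q := by positivity
        linarith)
    have e1 : α * (α ^ (-(1 / q))) ^ (a + b) = α ^ (1 - (a + b : ℝ) / q) := by
      rw [← Real.rpow_natCast, ← Real.rpow_mul h0.le]
      nth_rewrite 1 [← Real.rpow_one α]
      rw [← Real.rpow_add h0]
      congr 1
      push_cast
      field_simp
      ring
    have e2 : (α ^ (-(1 / q))) ^ ((a + b : ℝ) - q) = α ^ (1 - (a + b : ℝ) / q) := by
      rw [← Real.rpow_mul h0.le]
      congr 1
      field_simp
      ring
    have := hlev _ hL
    rw [mul_assoc, e1, e2] at this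
    linarith

end CovarianceInequality

/-! ### Second-moment bounds for sums and lagged products of a moment-mixing sequence. -/

section MomentMixing

variable {Ω : Type*} [MeasurableSpace Ω] {P : Measure Ω}

/-- A sequence supported on `{0, …, n - 1}` whose mixed moments up to order four decay with the
gaps between the indices, at the summable rate `ρ`. -/
structure IsMomentMixing (P : Measure Ω) (n : ℕ) (c R : ℝ) (ρ : ℕ → ℝ) (x : ℕ → Ω → ℝ) :
    Prop where
  measurable : ∀ t, Measurable (x t)
  eq_zero : ∀ t, n ≤ t → ∀ ω, x t ω = 0
  integrable_pow : ∀ t, Integrable (fun ω => x t ω ^ 4) P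
  c_nonneg : 0 ≤ c
  rate_nonneg : ∀ j, 0 ≤ ρ j
  rate_zero : ρ 0 = 1
  rate_antitone : Antitone ρ
  rate_sum : ∀ N, ∑ j ∈ Finset.range N, ρ j ≤ R
  moment_two : ∀ s t, s ≤ t → |∫ ω, x s ω * x t ω ∂P| ≤ c * ρ (t - s)
  moment_one_three : ∀ s t u v, s ≤ t → s ≤ u → s ≤ v →
    |∫ ω, x s ω * x t ω * (x u ω * x v ω) ∂P| ≤ c * ρ (min t (min u v) - s)
  cov_two_two : ∀ s t u v, s ≤ t → t ≤ u → u ≤ v →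
    |∫ ω, x s ω * x t ω * (x u ω * x v ω) ∂P -
      (∫ ω, x s ω * x t ω ∂P) * ∫ ω, x u ω * x v ω ∂P| ≤ c * ρ (u - t)

theorem abs_mul_mul_mul_le (a b c d : ℝ) :
    |a * b * (c * d)| ≤ a ^ 4 + b ^ 4 + c ^ 4 + d ^ 4 := by
  rw [abs_le]
  constructor <;>
  nlinarith [sq_nonneg (a * b - c * d), sq_nonneg (a * b + c * d), sq_nonneg (a ^ 2 - b ^ 2),
    sq_nonneg (c ^ 2 - d ^ 2), sq_nonneg (a ^ 2), sq_nonneg (b ^ 2), sq_nonneg (c ^ 2),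
    sq_nonneg (d ^ 2)]

theorem integrable_mul_mul_mul {f g h k : Ω → ℝ} (hf : Measurable f) (hg : Measurable g)
    (hh : Measurable h) (hk : Measurable k) (if4 : Integrable (fun ω => f ω ^ 4) P)
    (ig4 : Integrable (fun ω => g ω ^ 4) P) (ih4 : Integrable (fun ω => h ω ^ 4) P)
    (ik4 : Integrable (fun ω => k ω ^ 4) P) :
    Integrable (fun ω => f ω * g ω * (h ω * k ω)) P :=
  (((if4.add ig4).add ih4).add ik4).mono' ((hf.mul hg).mul (hh.mul hk)).aestronglyMeasurable
    (ae_of_all _ fun _ => abs_mul_mul_mul_le _ _ _ _)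

theorem integral_sq_sum {ι : Type*} (s : Finset ι) (f : ι → Ω → ℝ)
    (h2 : ∀ p q, Integrable (fun ω => f p ω * f q ω) P) :
    ∫ ω, (∑ p ∈ s, f p ω) ^ 2 ∂P = ∑ p ∈ s, ∑ q ∈ s, ∫ ω, f p ω * f q ω ∂P := by
  simp_rw [sq, Finset.sum_mul_sum]
  rw [integral_finsetSum _ fun p _ => integrable_finsetSum _ fun q _ => h2 p q]
  exact Finset.sum_congr rfl fun p _ => integral_finsetSum _ fun q _ => h2 p q

theorem integral_sq_sum_sub_integral [IsProbabilityMeasure P] {ι : Type*} (s : Finset ι)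
    (f : ι → Ω → ℝ) (h1 : ∀ p, Integrable (f p) P)
    (h2 : ∀ p q, Integrable (fun ω => f p ω * f q ω) P) :
    ∫ ω, (∑ p ∈ s, f p ω - ∫ ω', ∑ p ∈ s, f p ω' ∂P) ^ 2 ∂P =
      ∑ p ∈ s, ∑ q ∈ s, (∫ ω, f p ω * f q ω ∂P - (∫ ω, f p ω ∂P) * ∫ ω, f q ω ∂P) := by
  have e : ∀ p q ω, (f p ω - ∫ ω', f p ω' ∂P) * (f q ω - ∫ ω', f q ω' ∂P) =
      f p ω * f q ω - f p ω * (∫ ω', f q ω' ∂P) - (∫ ω', f p ω' ∂P) * f q ω +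
      (∫ ω', f p ω' ∂P) * (∫ ω', f q ω' ∂P) := by
    intros; ring
  have i1 := fun p q => (h2 p q).sub ((h1 p).mul_const (∫ ω', f q ω' ∂P))
  have i2 := fun p q => (i1 p q).sub ((h1 q).const_mul (∫ ω', f p ω' ∂P))
  have := integral_sq_sum (P := P) s (fun p ω => f p ω - ∫ ω', f p ω' ∂P) (by
    intro p q
    simp only [e]
    exact (i2 p q).add (integrable_const _))
  rw [integral_finsetSum _ fun p _ => h1 p]
  simp_rw [← Finset.sum_sub_distrib]
  rw [this]
  refine Finset.sum_congr rfl fun p _ => Finset.sum_congr rfl fun q _ => ?_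
  simp only [e]
  have a1 := integral_add (i2 p q) (integrable_const ((∫ ω', f p ω' ∂P) * (∫ ω', f q ω' ∂P)))
  have a2 := integral_sub (i1 p q) ((h1 q).const_mul (∫ ω', f p ω' ∂P))
  have a3 := integral_sub (h2 p q) ((h1 p).mul_const (∫ ω', f q ω' ∂P))
  simp only [Pi.sub_apply] at a1 a2 a3
  rw [a1, a2, a3, integral_mul_const, integral_const_mul]
  simp

/-- After a shift this is a partial sum of `ρ`. The bound is free of `a` and `n`, so double sums
over index pairs grow only linearly in `n`. -/
theorem sum_ite_rate_sub_le {ρ : ℕ → ℝ} {R : ℝ}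
    (hR : ∀ N, ∑ j ∈ Finset.range N, ρ j ≤ R) (n a : ℕ) :
    ∑ j ∈ Finset.range n, (if a ≤ j then ρ (j - a) else 0) ≤ R := by
  rcases le_total a n with h | h
  · obtain ⟨m, rfl⟩ := Nat.exists_eq_add_of_le h
    rw [Finset.sum_range_add]
    have : ∑ j ∈ Finset.range a, (if a ≤ j then ρ (j - a) else 0) = 0 :=
      Finset.sum_eq_zero fun j hj => if_neg (by simpa using hj)
    rw [this, zero_add]
    simpa using hR m
  · rw [Finset.sum_eq_zero fun j hj => if_neg (by have := Finset.mem_range.1 hj; omega)]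
    simpa using hR 0

/-- The weight of the `i`-th lag. -/
def lagWeight (i : ℕ) : ℝ := if i = 0 then 1 else 2

theorem lagWeight_nonneg (i : ℕ) : 0 ≤ lagWeight i := by
  unfold lagWeight; split_ifs <;> norm_num

theorem lagWeight_le (i : ℕ) : lagWeight i ≤ 2 := by
  unfold lagWeight; split_ifs <;> norm_num

/-- The estimator `tauHatSq` without centering. -/
noncomputable def lagProductSum (n B : ℕ) (y : ℕ → ℝ) : ℝ :=
  (1 / (n : ℝ)) * ∑ p ∈ Finset.range (B + 1) ×ˢ Finset.range n,
    lagWeight p.1 * (y p.2 * y (p.2 + p.1))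

namespace IsMomentMixing

variable {n : ℕ} {c R : ℝ} {ρ : ℕ → ℝ} {x : ℕ → Ω → ℝ}

theorem R_nonneg (H : IsMomentMixing P n c R ρ x) : 0 ≤ R := by simpa using H.rate_sum 0

theorem integrable_four (H : IsMomentMixing P n c R ρ x) (s t u v : ℕ) :
    Integrable (fun ω => x s ω * x t ω * (x u ω * x v ω)) P :=
  integrable_mul_mul_mul (H.measurable s) (H.measurable t) (H.measurable u) (H.measurable v)
    (H.integrable_pow s) (H.integrable_pow t) (H.integrable_pow u) (H.integrable_pow v)

theorem integrable_two [IsProbabilityMeasure P] (H : IsMomentMixing P n c R ρ x) (s t : ℕ) :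
    Integrable (fun ω => x s ω * x t ω) P := by
  have := integrable_mul_mul_mul (P := P) (H.measurable s) (H.measurable t)
    (measurable_const (a := (1 : ℝ))) (measurable_const (a := (1 : ℝ)))
    (H.integrable_pow s) (H.integrable_pow t) (integrable_const _) (integrable_const _)
  simpa using this

theorem integral_sq_sum_le [IsProbabilityMeasure P] (H : IsMomentMixing P n c R ρ x)
    (N a : ℕ) : ∫ ω, (∑ j ∈ Finset.range N, x (j + a) ω) ^ 2 ∂P ≤ 2 * c * R * N := by
  rw [integral_sq_sum _ _ fun p q => H.integrable_two _ _]
  have hb : ∀ p q, ∫ ω, x (p + a) ω * x (q + a) ω ∂P ≤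
      c * ((if p ≤ q then ρ (q - p) else 0) + if q ≤ p then ρ (p - q) else 0) := by
    intro p q
    refine (le_abs_self _).trans ?_
    rcases le_total p q with h | h
    · have := H.moment_two (p + a) (q + a) (by omega)
      rw [Nat.add_sub_add_right] at this
      refine this.trans (mul_le_mul_of_nonneg_left ?_ H.c_nonneg)
      rw [if_pos h]
      have : 0 ≤ if q ≤ p then ρ (p - q) else 0 := by
        split_ifs
        · exact H.rate_nonneg _
        · rfl
      linarith
    · have := H.moment_two (q + a) (p + a) (by omega)
      rw [Nat.add_sub_add_right] at this
      simp_rw [mul_comm (x (p + a) _)]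
      refine this.trans (mul_le_mul_of_nonneg_left ?_ H.c_nonneg)
      rw [if_pos h]
      have : 0 ≤ if p ≤ q then ρ (q - p) else 0 := by
        split_ifs
        · exact H.rate_nonneg _
        · rfl
      linarith
  have hs := fun p => sum_ite_rate_sub_le H.rate_sum N p
  calc _ ≤ ∑ p ∈ Finset.range N, ∑ q ∈ Finset.range N,
        c * ((if p ≤ q then ρ (q - p) else 0) + if q ≤ p then ρ (p - q) else 0) :=
        Finset.sum_le_sum fun p _ => Finset.sum_le_sum fun q _ => hb p q
    _ = c * (∑ p ∈ Finset.range N, ∑ q ∈ Finset.range N, (if p ≤ q then ρ (q - p) else 0) +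
        ∑ q ∈ Finset.range N, ∑ p ∈ Finset.range N, (if q ≤ p then ρ (p - q) else 0)) := by
        simp_rw [← Finset.mul_sum, Finset.sum_add_distrib]
        congr 2
        exact Finset.sum_comm
    _ ≤ c * (∑ _p ∈ Finset.range N, R + ∑ _p ∈ Finset.range N, R) := by
        refine mul_le_mul_of_nonneg_left ?_ H.c_nonneg
        exact add_le_add (Finset.sum_le_sum fun p _ => hs p) (Finset.sum_le_sum fun p _ => hs p)
    _ = 2 * c * R * N := by simp; ring

/-- Separated pairs (`j + i ≤ l`) are handled by `cov_two_two`. For interlacing pairs the covariance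
is not centered at all: `x j` alone is at distance `l - j` from the other three factors. The first
`if` is trivially true under `hjl`; it makes the bound a sum of the shape treated by
`sum_ite_rate_sub_le`. -/
theorem abs_cov_lag_products_le (H : IsMomentMixing P n c R ρ x) (i k j l : ℕ) (hjl : j ≤ l) :
    |∫ ω, x j ω * x (j + i) ω * (x l ω * x (l + k) ω) ∂P -
      (∫ ω, x j ω * x (j + i) ω ∂P) * ∫ ω, x l ω * x (l + k) ω ∂P| ≤
    (c + c ^ 2) * ((if j ≤ l then ρ (l - j) else 0) +
      if j + i ≤ l then ρ (l - (j + i)) else 0) := by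
  have hc := H.c_nonneg
  rw [if_pos hjl]
  have h1 := H.rate_nonneg (l - j)
  split_ifs with h
  · have h2 := H.rate_nonneg (l - (j + i))
    have := H.cov_two_two j (j + i) l (l + k) (by omega) h (by omega)
    have := mul_nonneg hc h1
    have := mul_nonneg (sq_nonneg c) h1
    have := mul_nonneg (sq_nonneg c) h2
    nlinarith
  · have e1 := H.moment_one_three j (j + i) l (l + k) (by omega) hjl (by omega)
    rw [show min (j + i) (min l (l + k)) = l by omega] at e1
    have e2 := H.moment_two j (j + i) (by omega)
    have e3 := H.moment_two l (l + k) (by omega)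
    -- Interlacing means `l - j < i`, so the product of the two means is controlled by the same gap.
    have r1 : ρ (j + i - j) ≤ ρ (l - j) := H.rate_antitone (by omega)
    have r2 : ρ (l + k - l) ≤ 1 := H.rate_zero ▸ H.rate_antitone (Nat.zero_le _)
    have e4 : |(∫ ω, x j ω * x (j + i) ω ∂P) * ∫ ω, x l ω * x (l + k) ω ∂P| ≤
        (c * ρ (l - j)) * (c * 1) := by
      rw [abs_mul]
      exact mul_le_mul (e2.trans (mul_le_mul_of_nonneg_left r1 hc))
        (e3.trans (mul_le_mul_of_nonneg_left r2 hc)) (abs_nonneg _) (mul_nonneg hc h1)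
    refine (abs_sub _ _).trans ?_
    nlinarith

theorem integral_sq_lagProductSum_sub_le [IsProbabilityMeasure P]
    (H : IsMomentMixing P n c R ρ x) (B : ℕ) :
    ∫ ω, (lagProductSum n B (fun t => x t ω) - ∫ ω', lagProductSum n B (fun t => x t ω') ∂P) ^ 2 ∂P
      ≤ 16 * (c + c ^ 2) * R * (B + 1) ^ 2 / n := by
  have hc := H.c_nonneg
  have hR := H.R_nonneg
  rcases Nat.eq_zero_or_pos n with h0 | hn
  · subst h0; simp [lagProductSum]
  have hn' : (0 : ℝ) < n := by exact_mod_cast hn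
  set Q := Finset.range (B + 1) ×ˢ Finset.range n with hQ
  set f : ℕ × ℕ → Ω → ℝ := fun p ω => lagWeight p.1 * (x p.2 ω * x (p.2 + p.1) ω) with hf
  have h1 : ∀ p, Integrable (f p) P := fun p => (H.integrable_two _ _).const_mul _
  have hmul : ∀ p q ω, f p ω * f q ω = (lagWeight p.1 * lagWeight q.1) *
      (x p.2 ω * x (p.2 + p.1) ω * (x q.2 ω * x (q.2 + q.1) ω)) := by
    intro p q ω; simp only [hf]; ring
  have h2 : ∀ p q, Integrable (fun ω => f p ω * f q ω) P := by
    intro p q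
    simp only [hmul]
    exact (H.integrable_four _ _ _ _).const_mul _
  have hT : ∀ ω, lagProductSum n B (fun t => x t ω) = (1 / (n : ℝ)) * ∑ p ∈ Q, f p ω :=
    fun ω => rfl
  simp_rw [hT, integral_const_mul, ← mul_sub, mul_pow, integral_const_mul]
  rw [integral_sq_sum_sub_integral Q f h1 h2]
  set G : ℕ × ℕ → ℕ × ℕ → ℝ := fun p q => (c + c ^ 2) *
    ((if p.2 ≤ q.2 then ρ (q.2 - p.2) else 0) +
      if p.2 + p.1 ≤ q.2 then ρ (q.2 - (p.2 + p.1)) else 0) with hG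
  have hG0 : ∀ p q, 0 ≤ G p q := by
    intro p q
    simp only [hG]
    refine mul_nonneg (by positivity) (add_nonneg ?_ ?_) <;> split_ifs <;>
      first | exact H.rate_nonneg _ | rfl
  -- The factor 4 bounds the two lag weights. Adding `G p q` and `G q p` covers both orders of the
  -- starting indices.
  have hcov : ∀ p q, ∫ ω, f p ω * f q ω ∂P - (∫ ω, f p ω ∂P) * ∫ ω, f q ω ∂P ≤
      4 * (G p q + G q p) := by
    intro p q
    refine (le_abs_self _).trans ?_
    have e : ∫ ω, f p ω * f q ω ∂P - (∫ ω, f p ω ∂P) * ∫ ω, f q ω ∂P =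
        (lagWeight p.1 * lagWeight q.1) *
        (∫ ω, x p.2 ω * x (p.2 + p.1) ω * (x q.2 ω * x (q.2 + q.1) ω) ∂P -
          (∫ ω, x p.2 ω * x (p.2 + p.1) ω ∂P) * ∫ ω, x q.2 ω * x (q.2 + q.1) ω ∂P) := by
      simp_rw [hmul]
      simp only [hf, integral_const_mul]
      ring
    have hw : lagWeight p.1 * lagWeight q.1 ≤ 4 := by
      nlinarith [lagWeight_nonneg p.1, lagWeight_nonneg q.1, lagWeight_le p.1, lagWeight_le q.1]
    have hw0 := mul_nonneg (lagWeight_nonneg p.1) (lagWeight_nonneg q.1)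
    rw [e, abs_mul, abs_of_nonneg hw0]
    refine mul_le_mul hw ?_ (abs_nonneg _) (by norm_num)
    rcases le_total p.2 q.2 with h | h
    · have := H.abs_cov_lag_products_le p.1 q.1 p.2 q.2 h
      exact this.trans (le_add_of_nonneg_right (hG0 q p))
    · have := H.abs_cov_lag_products_le q.1 p.1 q.2 p.2 h
      rw [mul_comm (∫ ω, x q.2 ω * x (q.2 + q.1) ω ∂P)] at this
      simp_rw [mul_comm (x q.2 _ * x (q.2 + q.1) _)] at this
      exact this.trans (le_add_of_nonneg_left (hG0 p q))
  have hsum : ∀ p, ∑ q ∈ Q, G p q ≤ (B + 1) * ((c + c ^ 2) * (2 * R)) := by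
    intro p
    rw [hQ, Finset.sum_product]
    simp only [hG]
    calc _ ≤ ∑ _k ∈ Finset.range (B + 1), (c + c ^ 2) * (2 * R) := by
          refine Finset.sum_le_sum fun k _ => ?_
          rw [← Finset.mul_sum, Finset.sum_add_distrib]
          refine mul_le_mul_of_nonneg_left ?_ (by positivity)
          have := sum_ite_rate_sub_le H.rate_sum n p.2
          have := sum_ite_rate_sub_le H.rate_sum n (p.2 + p.1)
          linarith
      _ = _ := by simp
  have htot : ∑ p ∈ Q, ∑ q ∈ Q,
      (∫ ω, f p ω * f q ω ∂P - (∫ ω, f p ω ∂P) * ∫ ω, f q ω ∂P) ≤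
      16 * (c + c ^ 2) * R * (B + 1) ^ 2 * n := by
    calc _ ≤ ∑ p ∈ Q, ∑ q ∈ Q, 4 * (G p q + G q p) :=
          Finset.sum_le_sum fun p _ => Finset.sum_le_sum fun q _ => hcov p q
      _ = 8 * ∑ p ∈ Q, ∑ q ∈ Q, G p q := by
          simp_rw [← Finset.mul_sum, Finset.sum_add_distrib]
          rw [Finset.sum_comm (f := fun p q => G q p)]
          ring
      _ ≤ 8 * ∑ _p ∈ Q, (B + 1) * ((c + c ^ 2) * (2 * R)) := by
          gcongr with p
          exact hsum p
      _ = 16 * (c + c ^ 2) * R * (B + 1) ^ 2 * n := by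
          simp [hQ]; ring
  calc _ ≤ (1 / (n : ℝ)) ^ 2 * (16 * (c + c ^ 2) * R * (B + 1) ^ 2 * n) :=
        mul_le_mul_of_nonneg_left htot (by positivity)
    _ = _ := by field_simp

end IsMomentMixing

end MomentMixing

/-! ### The cost of centering at the sample mean. -/

section Centering

theorem sum_range_succ_eq_zero_add_Icc (B : ℕ) (f : ℕ → ℝ) :
    ∑ i ∈ Finset.range (B + 1), f i = f 0 + ∑ i ∈ Finset.Icc 1 B, f i := by
  rw [Finset.range_eq_Ico, Finset.sum_eq_sum_Ico_succ_bot (Nat.succ_pos B)]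
  rfl

theorem tauHatSq_eq_sum_lagWeight {n : ℕ} (b : ℝ) (y : ℕ → ℝ) :
    tauHatSq b (fun i : Fin n => y i) = (1 / (n : ℝ)) * ∑ i ∈ Finset.range (⌊b⌋₊ + 1),
      lagWeight i * ∑ j ∈ Finset.range (n - i),
        (y j - sampleMean fun i : Fin n => y i) * (y (j + i) - sampleMean fun i : Fin n => y i) := by
  set m := sampleMean fun i : Fin n => y i with hm
  rw [sum_range_succ_eq_zero_add_Icc, tauHatSq, mul_add]
  congr 1
  · simp only [lagWeight, if_true, one_mul, Nat.sub_zero, add_zero, ← hm]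
    rw [Fin.sum_univ_eq_sum_range fun j => (y j - m) ^ 2]
    simp only [sq]
  · rw [show (2 / (n : ℝ)) = 1 / (n : ℝ) * 2 by ring, mul_assoc, Finset.mul_sum]
    congr 1
    refine Finset.sum_congr rfl fun i hi => ?_
    have : i ≠ 0 := by have := Finset.mem_Icc.1 hi; omega
    simp only [lagWeight, if_neg this, ← hm]
    rw [Fin.sum_univ_eq_sum_range fun j => (y j - m) * (y (j + i) - m)]

theorem abs_tauHatSq_sub_lagProductSum_le {n : ℕ} (hn : 0 < n) (b : ℝ) (y : ℕ → ℝ)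
    (hy : ∀ t, n ≤ t → y t = 0) :
    |tauHatSq b (fun i : Fin n => y i) - lagProductSum n ⌊b⌋₊ y| ≤
      (1 / (n : ℝ)) * ∑ i ∈ Finset.range (⌊b⌋₊ + 1), lagWeight i *
        (2 * (∑ j ∈ Finset.range n, y (j + 0)) ^ 2 / n +
          ((∑ j ∈ Finset.range (n - i), y (j + 0)) ^ 2 +
            (∑ j ∈ Finset.range (n - i), y (j + i)) ^ 2) / (2 * n)) := by
  have hn' : (0 : ℝ) < n := by exact_mod_cast hn
  rw [tauHatSq_eq_sum_lagWeight, lagProductSum, Finset.sum_product, ← mul_sub,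
    ← Finset.sum_sub_distrib, abs_mul, abs_of_nonneg (by positivity : 0 ≤ 1 / (n : ℝ))]
  refine mul_le_mul_of_nonneg_left ?_ (by positivity)
  refine (Finset.abs_sum_le_sum_abs _ _).trans (Finset.sum_le_sum fun i _ => ?_)
  simp only [← Finset.mul_sum]
  rw [← mul_sub, abs_mul, abs_of_nonneg (lagWeight_nonneg i)]
  refine mul_le_mul_of_nonneg_left ?_ (lagWeight_nonneg i)
  -- Since `y` vanishes from `n` on, products running over the end of the row contribute nothing.
  have hcut : ∑ j ∈ Finset.range n, y j * y (j + i) =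
      ∑ j ∈ Finset.range (n - i), y j * y (j + i) := by
    refine (Finset.sum_subset (Finset.range_mono (Nat.sub_le n i)) fun j _ hj => ?_).symm
    rw [hy (j + i) (by have := mt Finset.mem_range.2 hj; omega), mul_zero]
  simp only [add_zero, hcut]
  set m := sampleMean fun i : Fin n => y i with hm
  set S := ∑ j ∈ Finset.range n, y j with hS
  set A := ∑ j ∈ Finset.range (n - i), y j with hA
  set A' := ∑ j ∈ Finset.range (n - i), y (j + i) with hA'
  have hmS : m = S / n := by
    rw [hm, sampleMean, Fin.sum_univ_eq_sum_range fun j => y j]; ring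
  have hex : ∑ j ∈ Finset.range (n - i), (y j - m) * (y (j + i) - m) -
      ∑ j ∈ Finset.range (n - i), y j * y (j + i) = ((n - i : ℕ) : ℝ) * m ^ 2 - m * A - m * A' := by
    rw [← Finset.sum_sub_distrib, hA, hA', Finset.mul_sum, Finset.mul_sum]
    rw [show ((n - i : ℕ) : ℝ) * m ^ 2 = ∑ _j ∈ Finset.range (n - i), m ^ 2 by simp,
      ← Finset.sum_sub_distrib, ← Finset.sum_sub_distrib]
    exact Finset.sum_congr rfl fun j _ => by ring
  rw [hex]
  have hk : ((n - i : ℕ) : ℝ) ≤ n := by exact_mod_cast Nat.sub_le n i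
  have hk0 : (0 : ℝ) ≤ ((n - i : ℕ) : ℝ) := Nat.cast_nonneg _
  have hSn : S = n * m := by rw [hmS]; field_simp
  have hS2 : S ^ 2 / n = n * m ^ 2 := by rw [hSn]; field_simp
  -- Young's inequality with weight `n`. The two cross terms give `n * m ^ 2` in total, and with the
  -- term `(n - i) * m ^ 2` this makes the `2 * S ^ 2 / n` of the statement.
  have hyoung : ∀ z : ℝ, |m * z| ≤ n * m ^ 2 / 2 + z ^ 2 / (2 * n) := by
    intro z
    have e : n * m ^ 2 / 2 + z ^ 2 / (2 * n) - |m * z| = (n * |m| - |z|) ^ 2 / (2 * n) := by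
      rw [abs_mul, ← sq_abs m, ← sq_abs z]; field_simp; ring
    have : 0 ≤ (n * |m| - |z|) ^ 2 / (2 * n) := by positivity
    linarith
  have y1 := abs_le.1 (hyoung A)
  have y2 := abs_le.1 (hyoung A')
  have hm2 := sq_nonneg m
  rw [mul_div_assoc, hS2, add_div]
  rw [abs_le]
  constructor <;> nlinarith

end Centering

/-! ### `L¹` error of the estimator around the mean of the uncentered sum. -/

section EstimatorBound

variable {Ω : Type*} [MeasurableSpace Ω] {P : Measure Ω} [IsProbabilityMeasure P]

/-- Without centering and with the expectation as target, the estimator is accurate up to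
`O ((b + 1) / √n)` in `L¹`. -/
theorem IsMomentMixing.integral_abs_tauHatSq_sub_le {n : ℕ} {c R : ℝ} {ρ : ℕ → ℝ}
    {x : ℕ → Ω → ℝ} (H : IsMomentMixing P n c R ρ x) (hn : 0 < n) (b : ℝ) :
    Integrable (fun ω => tauHatSq b fun i : Fin n => x i ω) P ∧
    ∫ ω, |tauHatSq b (fun i : Fin n => x i ω) -
        ∫ ω', lagProductSum n ⌊b⌋₊ (fun t => x t ω') ∂P| ∂P ≤
      (12 * c * R + 8 * (c + c ^ 2) * R + 1) * ((⌊b⌋₊ + 1) / √n) := by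
  have hn' : (0 : ℝ) < n := by exact_mod_cast hn
  have hc := H.c_nonneg
  have hR := H.R_nonneg
  set B := ⌊b⌋₊
  set T : Ω → ℝ := fun ω => lagProductSum n B (fun t => x t ω) with hT
  have hTi : Integrable T P := by
    simp only [hT, lagProductSum]
    exact (integrable_finsetSum _ fun p _ => (H.integrable_two _ _).const_mul _).const_mul _
  have hsqi : ∀ N a, Integrable (fun ω => (∑ j ∈ Finset.range N, x (j + a) ω) ^ 2) P := by
    intro N a
    simp_rw [sq, Finset.sum_mul_sum]
    exact integrable_finsetSum _ fun p _ => integrable_finsetSum _ fun q _ =>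
      H.integrable_two _ _
  have hsqle : ∀ N a, N ≤ n →
      ∫ ω, (∑ j ∈ Finset.range N, x (j + a) ω) ^ 2 ∂P ≤ 2 * c * R * n := by
    intro N a hN
    refine (H.integral_sq_sum_le N a).trans (mul_le_mul_of_nonneg_left ?_ (by positivity))
    exact_mod_cast hN
  set V : Ω → ℝ := fun ω => (1 / (n : ℝ)) * ∑ i ∈ Finset.range (B + 1), lagWeight i *
        (2 * (∑ j ∈ Finset.range n, x (j + 0) ω) ^ 2 / n +
          ((∑ j ∈ Finset.range (n - i), x (j + 0) ω) ^ 2 +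
            (∑ j ∈ Finset.range (n - i), x (j + i) ω) ^ 2) / (2 * n)) with hV
  have i1 : ∀ i, Integrable (fun ω => lagWeight i *
      (2 * (∑ j ∈ Finset.range n, x (j + 0) ω) ^ 2 / n +
          ((∑ j ∈ Finset.range (n - i), x (j + 0) ω) ^ 2 +
            (∑ j ∈ Finset.range (n - i), x (j + i) ω) ^ 2) / (2 * n))) P := fun i =>
    ((((hsqi n 0).const_mul 2).div_const _).add
      (((hsqi (n - i) 0).add (hsqi (n - i) i)).div_const _)).const_mul _
  have hVi : Integrable V P := (integrable_finsetSum _ fun i _ => i1 i).const_mul _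
  have hVle : ∫ ω, V ω ∂P ≤ 12 * c * R * ((B + 1) / n) := by
    simp only [hV]
    rw [integral_const_mul, integral_finsetSum _ fun i _ => i1 i]
    have hterm : ∀ i ∈ Finset.range (B + 1), ∫ ω, lagWeight i *
        (2 * (∑ j ∈ Finset.range n, x (j + 0) ω) ^ 2 / n +
          ((∑ j ∈ Finset.range (n - i), x (j + 0) ω) ^ 2 +
            (∑ j ∈ Finset.range (n - i), x (j + i) ω) ^ 2) / (2 * n)) ∂P ≤
        -- The lag weight is at most 2. Block sums have second moment at most `2 * c * R * n`, so
        -- the bracket is at most `4 * c * R + 2 * c * R`.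
        2 * (6 * c * R) := by
      intro i _
      have a1 := integral_add (hsqi (n - i) 0) (hsqi (n - i) i)
      have a2 := integral_add (((hsqi n 0).const_mul 2).div_const (n : ℝ))
        (((hsqi (n - i) 0).add (hsqi (n - i) i)).div_const (2 * (n : ℝ)))
      simp only [Pi.add_apply] at a1 a2
      rw [integral_const_mul, a2, integral_div, integral_div, integral_const_mul, a1]
      refine mul_le_mul (lagWeight_le i) ?_ ?_ (by norm_num)
      · have b1 := hsqle n 0 le_rfl
        have b2 := hsqle (n - i) 0 (Nat.sub_le n i)
        have b3 := hsqle (n - i) i (Nat.sub_le n i)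
        calc _ ≤ 2 * (2 * c * R * n) / n + (2 * c * R * n + 2 * c * R * n) / (2 * n) := by gcongr
          _ = 6 * c * R := by field_simp; ring
      · have b0 : ∀ N a, 0 ≤ ∫ ω, (∑ j ∈ Finset.range N, x (j + a) ω) ^ 2 ∂P :=
          fun N a => integral_nonneg fun ω => sq_nonneg _
        have b1 := b0 n 0
        have b2 := b0 (n - i) 0
        have b3 := b0 (n - i) i
        positivity
    calc _ ≤ 1 / (n : ℝ) * ∑ _i ∈ Finset.range (B + 1), 2 * (6 * c * R) :=
          mul_le_mul_of_nonneg_left (Finset.sum_le_sum hterm) (by positivity)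
      _ = _ := by simp; ring
  have hdiff : ∀ ω, |tauHatSq b (fun i : Fin n => x i ω) - T ω| ≤ V ω := fun ω =>
    abs_tauHatSq_sub_lagProductSum_le hn b (fun t => x t ω) fun t ht => H.eq_zero t ht ω
  have hmeas : Measurable fun ω => tauHatSq b fun i : Fin n => x i ω := by
    simp only [tauHatSq, sampleMean]
    have := H.measurable
    fun_prop
  set e := ∫ ω', lagProductSum n B (fun t => x t ω') ∂P with he
  have hT2i : Integrable (fun ω => (T ω - e) ^ 2) P := by
    have : Integrable (fun ω => T ω ^ 2) P := by
      simp only [hT, lagProductSum, mul_pow]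
      refine Integrable.const_mul ?_ _
      simp_rw [sq, Finset.sum_mul_sum]
      refine integrable_finsetSum _ fun p _ => integrable_finsetSum _ fun q _ => ?_
      have hm : ∀ ω, lagWeight p.1 * (x p.2 ω * x (p.2 + p.1) ω) *
          (lagWeight q.1 * (x q.2 ω * x (q.2 + q.1) ω)) = (lagWeight p.1 * lagWeight q.1) *
          (x p.2 ω * x (p.2 + p.1) ω * (x q.2 ω * x (q.2 + q.1) ω)) := fun ω => by ring
      simp only [hm]
      exact (H.integrable_four _ _ _ _).const_mul _
    have h3 := (this.sub (hTi.const_mul (2 * e))).add (integrable_const (e ^ 2))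
    refine h3.congr (ae_of_all _ fun ω => ?_)
    simp only [Pi.add_apply, Pi.sub_apply]
    ring
  have hvar : ∫ ω, (T ω - e) ^ 2 ∂P ≤ 16 * (c + c ^ 2) * R * (B + 1) ^ 2 / n :=
    H.integral_sq_lagProductSum_sub_le B
  have hsn : 0 < √(n : ℝ) := Real.sqrt_pos.2 hn'
  have hB1 : (0 : ℝ) < B + 1 := by positivity
  have hs0 : 0 < √(n : ℝ) / (B + 1) := div_pos hsn hB1
  -- The weight that balances the two terms of `|u| ≤ s / 2 * u ^ 2 + 1 / (2 * s)` when `u ^ 2` has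
  -- mean of order `((B + 1) / √n) ^ 2`.
  set s := √(n : ℝ) / (B + 1) with hs
  have hTi' : Integrable (fun ω => |T ω - e|) P := (hTi.sub (integrable_const e)).abs
  have hTL1 : ∫ ω, |T ω - e| ∂P ≤ (8 * (c + c ^ 2) * R + 1) * ((B + 1) / √n) := by
    have hpt : ∀ ω, |T ω - e| ≤ s / 2 * (T ω - e) ^ 2 + 1 / (2 * s) := by
      intro ω
      have e1 : s / 2 * (T ω - e) ^ 2 + 1 / (2 * s) - |T ω - e| =
          (s * |T ω - e| - 1) ^ 2 / (2 * s) := by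
        rw [← sq_abs (T ω - e)]; field_simp; ring
      have : 0 ≤ (s * |T ω - e| - 1) ^ 2 / (2 * s) := by positivity
      linarith
    calc ∫ ω, |T ω - e| ∂P ≤ ∫ ω, (s / 2 * (T ω - e) ^ 2 + 1 / (2 * s)) ∂P :=
          integral_mono hTi' ((hT2i.const_mul _).add (integrable_const _)) hpt
      _ = s / 2 * ∫ ω, (T ω - e) ^ 2 ∂P + 1 / (2 * s) := by
          rw [integral_add (hT2i.const_mul _) (integrable_const _), integral_const_mul]; simp
      _ ≤ s / 2 * (16 * (c + c ^ 2) * R * (B + 1) ^ 2 / n) + 1 / (2 * s) := by gcongr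
      _ = (8 * (c + c ^ 2) * R + 1 / 2) * ((B + 1) / √n) := by
          rw [hs]
          have hsq : (n : ℝ) = √n * √n := (Real.mul_self_sqrt hn'.le).symm
          generalize √(n : ℝ) = r at *
          rw [hsq]
          field_simp
          ring
      _ ≤ _ := by gcongr; norm_num
  have hi : Integrable (fun ω => tauHatSq b fun i : Fin n => x i ω) P := by
    have : Integrable (fun ω => tauHatSq b (fun i : Fin n => x i ω) - T ω) P :=
      hVi.mono' (hmeas.aestronglyMeasurable.sub hTi.aestronglyMeasurable)
        (ae_of_all _ fun ω => hdiff ω)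
    exact (this.add hTi).congr (ae_of_all _ fun ω => sub_add_cancel _ _)
  refine ⟨hi, ?_⟩
  have h1n : 1 / (n : ℝ) ≤ 1 / √n := by
    refine one_div_le_one_div_of_le hsn ?_
    rw [Real.sqrt_le_left (by positivity)]
    have : (1 : ℝ) ≤ n := by exact_mod_cast hn
    nlinarith
  calc _ ≤ ∫ ω, (V ω + |T ω - e|) ∂P := by
        refine integral_mono (hi.sub (integrable_const e)).abs (hVi.add hTi') fun ω => ?_
        have := abs_sub_le (tauHatSq b fun i : Fin n => x i ω) (T ω) e
        have := hdiff ω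
        simp only
        linarith
    _ = ∫ ω, V ω ∂P + ∫ ω, |T ω - e| ∂P := integral_add hVi hTi'
    _ ≤ 12 * c * R * ((B + 1) / √n) + (8 * (c + c ^ 2) * R + 1) * ((B + 1) / √n) := by
        refine add_le_add (hVle.trans ?_) hTL1
        refine mul_le_mul_of_nonneg_left ?_ (by positivity)
        rw [div_eq_mul_one_div, div_eq_mul_one_div ((B : ℝ) + 1)]
        exact mul_le_mul_of_nonneg_left h1n hB1.le
    _ = _ := by ring

end EstimatorBound

/-! ### From α-mixing of a row to decay of its mixed moments. -/

section RowMixing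

variable {Ω : Type*} {n : ℕ}

/-- The extension of a row by zeros. -/
noncomputable def extendRow (X : Fin n → Ω → ℝ) (t : ℕ) (ω : Ω) : ℝ :=
  if h : t < n then X ⟨t, h⟩ ω else 0

theorem extendRow_of_lt (X : Fin n → Ω → ℝ) {t : ℕ} (h : t < n) :
    extendRow X t = X ⟨t, h⟩ := by
  funext ω; simp [extendRow, h]

theorem extendRow_of_le (X : Fin n → Ω → ℝ) {t : ℕ} (h : n ≤ t) :
    extendRow X t = fun _ => 0 := by
  funext ω; simp [extendRow, Nat.not_lt.2 h]

theorem extendRow_coe (X : Fin n → Ω → ℝ) (i : Fin n) (ω : Ω) : extendRow X i ω = X i ω := by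
  simp [extendRow]

theorem rowFuture_antitone (X : Fin n → Ω → ℝ) : Antitone (rowFuture X) := by
  intro k l hkl
  refine iSup_le fun i => ?_
  exact le_iSup (fun i : {i : Fin n // k ≤ (i : ℕ)} =>
    MeasurableSpace.comap (X i) inferInstance) ⟨i.1, hkl.trans i.2⟩

theorem tauHatSq_extendRow (X : Fin n → Ω → ℝ) (b : ℝ) (ω : Ω) :
    tauHatSq b (fun i => X i ω) = tauHatSq b (fun i : Fin n => extendRow X i ω) := by
  simp only [extendRow_coe]

theorem stronglyMeasurable_rowPast_extendRow (X : Fin n → Ω → ℝ) {t k : ℕ} (h : t ≤ k) :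
    StronglyMeasurable[rowPast X k] (extendRow X t) := by
  rcases lt_or_ge t n with ht | ht
  · rw [extendRow_of_lt X ht]
    refine Measurable.stronglyMeasurable (Measurable.mono (comap_measurable _) ?_ le_rfl)
    exact le_iSup (fun i : {i : Fin n // (i : ℕ) ≤ k} =>
      MeasurableSpace.comap (X i) inferInstance) ⟨⟨t, ht⟩, h⟩
  · rw [extendRow_of_le X ht]
    exact stronglyMeasurable_const

theorem stronglyMeasurable_rowFuture_extendRow (X : Fin n → Ω → ℝ) {t k : ℕ} (h : k ≤ t) :
    StronglyMeasurable[rowFuture X k] (extendRow X t) := by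
  rcases lt_or_ge t n with ht | ht
  · rw [extendRow_of_lt X ht]
    refine Measurable.stronglyMeasurable (Measurable.mono (comap_measurable _) ?_ le_rfl)
    exact le_iSup (fun i : {i : Fin n // k ≤ (i : ℕ)} =>
      MeasurableSpace.comap (X i) inferInstance) ⟨⟨t, ht⟩, h⟩
  · rw [extendRow_of_le X ht]
    exact stronglyMeasurable_const

variable [MeasurableSpace Ω] {P : Measure Ω}

theorem rowPast_le {X : Fin n → Ω → ℝ} (hX : ∀ i, Measurable (X i)) (k : ℕ) :
    rowPast X k ≤ ‹MeasurableSpace Ω› :=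
  iSup_le fun i => (hX i).comap_le

theorem rowFuture_le {X : Fin n → Ω → ℝ} (hX : ∀ i, Measurable (X i)) (k : ℕ) :
    rowFuture X k ≤ ‹MeasurableSpace Ω› :=
  iSup_le fun i => (hX i).comap_le

theorem abs_measureReal_inter_sub_mul_le_one [IsProbabilityMeasure P] (A B : Set Ω) :
    |P.real (A ∩ B) - P.real A * P.real B| ≤ 1 := by
  have h1 : P.real (A ∩ B) ≤ 1 := measureReal_le_one
  have h2 : P.real A ≤ 1 := measureReal_le_one
  have h3 : P.real B ≤ 1 := measureReal_le_one
  have h4 : 0 ≤ P.real (A ∩ B) := measureReal_nonneg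
  have h5 : 0 ≤ P.real A := measureReal_nonneg
  have h6 : 0 ≤ P.real B := measureReal_nonneg
  rw [abs_le]
  constructor <;> nlinarith

/-- The mixing coefficients of a row, with the trivial bound `1` at lag `0`. -/
noncomputable def lagAlpha (P : Measure Ω) (X : Fin n → Ω → ℝ) (j : ℕ) : ℝ :=
  if j = 0 then 1 else rowAlpha P X j

theorem integral_extendRow {X : Fin n → Ω → ℝ} (hmean : ∀ i, ∫ ω, X i ω ∂P = 0) (t : ℕ) :
    ∫ ω, extendRow X t ω ∂P = 0 := by
  rcases lt_or_ge t n with ht | ht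
  · rw [extendRow_of_lt X ht]; exact hmean _
  · simp [extendRow_of_le X ht]

/-- The rate at which the mixed moments of a row decay. -/
noncomputable def mixingRate (P : Measure Ω) (X : Fin n → Ω → ℝ) (δ : ℝ) (j : ℕ) : ℝ :=
  lagAlpha P X j ^ (δ / (2 + δ))

theorem mixingRate_zero (X : Fin n → Ω → ℝ) (δ : ℝ) : mixingRate P X δ 0 = 1 := by
  simp [mixingRate, lagAlpha]

variable [IsProbabilityMeasure P]

theorem bddAbove_rowAlpha (X : Fin n → Ω → ℝ) (j : ℕ) :
    BddAbove {r : ℝ | ∃ (k : ℕ) (A B : Set Ω),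
      MeasurableSet[rowPast X k] A ∧ MeasurableSet[rowFuture X (k + j)] B ∧
      r = |P.real (A ∩ B) - P.real A * P.real B|} := by
  refine ⟨1, ?_⟩
  rintro r ⟨k, A, B, _, _, rfl⟩
  exact abs_measureReal_inter_sub_mul_le_one A B

theorem nonempty_rowAlpha (P : Measure Ω) (X : Fin n → Ω → ℝ) (j : ℕ) :
    {r : ℝ | ∃ (k : ℕ) (A B : Set Ω),
      MeasurableSet[rowPast X k] A ∧ MeasurableSet[rowFuture X (k + j)] B ∧
      r = |P.real (A ∩ B) - P.real A * P.real B|}.Nonempty :=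
  ⟨_, 0, ∅, ∅, @MeasurableSet.empty Ω (rowPast X 0), @MeasurableSet.empty Ω (rowFuture X (0 + j)),
    rfl⟩

theorem le_rowAlpha (X : Fin n → Ω → ℝ) (k j : ℕ) {A B : Set Ω}
    (hA : MeasurableSet[rowPast X k] A) (hB : MeasurableSet[rowFuture X (k + j)] B) :
    |P.real (A ∩ B) - P.real A * P.real B| ≤ rowAlpha P X j :=
  le_csSup (bddAbove_rowAlpha X j) ⟨k, A, B, hA, hB, rfl⟩

theorem rowAlpha_nonneg (X : Fin n → Ω → ℝ) (j : ℕ) : 0 ≤ rowAlpha P X j := by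
  refine (abs_nonneg _).trans (le_rowAlpha (P := P) X 0 j (A := ∅) (B := ∅) ?_ ?_)
  · exact @MeasurableSet.empty Ω (rowPast X 0)
  · exact @MeasurableSet.empty Ω (rowFuture X (0 + j))

theorem rowAlpha_le_one (X : Fin n → Ω → ℝ) (j : ℕ) : rowAlpha P X j ≤ 1 := by
  refine csSup_le (nonempty_rowAlpha P X j) ?_
  rintro r ⟨k, A, B, _, _, rfl⟩
  exact abs_measureReal_inter_sub_mul_le_one A B

theorem rowAlpha_antitone (X : Fin n → Ω → ℝ) : Antitone (rowAlpha P X) := by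
  intro i j hij
  refine csSup_le_csSup (bddAbove_rowAlpha X i) (nonempty_rowAlpha P X j) ?_
  rintro r ⟨k, A, B, hA, hB, rfl⟩
  exact ⟨k, A, B, hA, rowFuture_antitone X (by omega : k + i ≤ k + j) _ hB, rfl⟩

/-- Past the end of the row the future σ-algebra is trivial. Hence the assumption on lags `1, …, n -
1` controls partial sums of any length. -/
theorem rowAlpha_eq_zero (X : Fin n → Ω → ℝ) {j : ℕ} (hj : n ≤ j) : rowAlpha P X j = 0 := by
  refine le_antisymm (csSup_le (nonempty_rowAlpha P X j) ?_) (rowAlpha_nonneg X j)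
  rintro r ⟨k, A, B, _, hB, rfl⟩
  have : IsEmpty {i : Fin n // k + j ≤ (i : ℕ)} := ⟨fun i => by have := i.2; have := i.1.2; omega⟩
  have hbot : rowFuture X (k + j) = ⊥ := iSup_of_empty _
  rw [hbot, MeasurableSpace.measurableSet_bot_iff] at hB
  rcases hB with rfl | rfl <;> simp

theorem lagAlpha_nonneg (X : Fin n → Ω → ℝ) (j : ℕ) : 0 ≤ lagAlpha P X j := by
  unfold lagAlpha
  split_ifs
  · exact zero_le_one
  · exact rowAlpha_nonneg X j

theorem lagAlpha_le_one (X : Fin n → Ω → ℝ) (j : ℕ) : lagAlpha P X j ≤ 1 := by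
  unfold lagAlpha
  split_ifs
  · exact le_rfl
  · exact rowAlpha_le_one X j

theorem lagAlpha_antitone (X : Fin n → Ω → ℝ) : Antitone (lagAlpha P X) := by
  intro i j hij
  rcases Nat.eq_zero_or_pos i with rfl | hi
  · simpa [lagAlpha] using lagAlpha_le_one (P := P) X j
  · rw [lagAlpha, lagAlpha, if_neg (by omega), if_neg (by omega)]
    exact rowAlpha_antitone X hij

theorem le_lagAlpha (X : Fin n → Ω → ℝ) (k j : ℕ) {A B : Set Ω}
    (hA : MeasurableSet[rowPast X k] A) (hB : MeasurableSet[rowFuture X (k + j)] B) :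
    |P.real (A ∩ B) - P.real A * P.real B| ≤ lagAlpha P X j := by
  unfold lagAlpha
  split_ifs
  · exact abs_measureReal_inter_sub_mul_le_one A B
  · exact le_rowAlpha X k j hA hB

/-- The constant in the covariance inequality for four entries with `q`-th moments at
most `K`. -/
def covConst (K : ℝ) : ℝ := 4 + 2 * (4 * K + 4 * K * (1 + 4 * K))

/-- Davydov's inequality with `D` the largest of four absolute entries; `D ^ q` is at most the sum
of the four `q`-th powers, hence the moment bound `4 * K`. Quantifying over every `d` that dominates
the entries lets one statement serve the splittings 1+1, 1+3 and 2+2. -/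
theorem abs_cov_extendRow_le {X : Fin n → Ω → ℝ} {q K : ℝ} (hX : ∀ i, Measurable (X i))
    (hq0 : 0 < q) (hK : 0 ≤ K) (hmom : ∀ i, Integrable (fun ω => |X i ω| ^ q) P ∧
      ∫ ω, |X i ω| ^ q ∂P ≤ K)
    (k j s t u v a b : ℕ) (hab : (a + b : ℝ) < q) {Y Z : Ω → ℝ}
    (hY : StronglyMeasurable[rowPast X k] Y) (hZ : StronglyMeasurable[rowFuture X (k + j)] Z)
    (hYD : ∀ ω (d : ℝ), |extendRow X s ω| ≤ d → |extendRow X t ω| ≤ d → |extendRow X u ω| ≤ d →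
      |extendRow X v ω| ≤ d → |Y ω| ≤ d ^ a)
    (hZD : ∀ ω (d : ℝ), |extendRow X s ω| ≤ d → |extendRow X t ω| ≤ d → |extendRow X u ω| ≤ d →
      |extendRow X v ω| ≤ d → |Z ω| ≤ d ^ b) :
    |∫ ω, Y ω * Z ω ∂P - (∫ ω, Y ω ∂P) * ∫ ω, Z ω ∂P| ≤
      covConst K * lagAlpha P X j ^ (1 - (a + b : ℝ) / q) := by
  set x := extendRow X with hx
  have hxm : ∀ t, Measurable (x t) := by
    intro t
    rcases lt_or_ge t n with ht | ht
    · rw [hx, extendRow_of_lt X ht]; exact hX _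
    · rw [hx, extendRow_of_le X ht]; exact measurable_const
  have hxi : ∀ t, Integrable (fun ω => |x t ω| ^ q) P ∧ ∫ ω, |x t ω| ^ q ∂P ≤ K := by
    intro t
    rcases lt_or_ge t n with ht | ht
    · rw [hx, extendRow_of_lt X ht]; exact hmom _
    · rw [hx, extendRow_of_le X ht]; simpa [Real.zero_rpow hq0.ne'] using hK
  set D : Ω → ℝ := fun ω => max (max |x s ω| |x t ω|) (max |x u ω| |x v ω|) with hD
  have d1 : ∀ ω, |x s ω| ≤ D ω := fun ω => (le_max_left _ _).trans (le_max_left _ _)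
  have d2 : ∀ ω, |x t ω| ≤ D ω := fun ω => (le_max_right _ _).trans (le_max_left _ _)
  have d3 : ∀ ω, |x u ω| ≤ D ω := fun ω => (le_max_left _ _).trans (le_max_right _ _)
  have d4 : ∀ ω, |x v ω| ≤ D ω := fun ω => (le_max_right _ _).trans (le_max_right _ _)
  have hD0 : ∀ ω, 0 ≤ D ω := fun ω => (abs_nonneg _).trans (d1 ω)
  have hDm : Measurable D :=
    ((hxm s).abs.max (hxm t).abs).max ((hxm u).abs.max (hxm v).abs)
  have hDle : ∀ ω, D ω ^ q ≤ |x s ω| ^ q + |x t ω| ^ q + |x u ω| ^ q + |x v ω| ^ q := by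
    intro ω
    have h1 := Real.rpow_nonneg (abs_nonneg (x s ω)) q
    have h2 := Real.rpow_nonneg (abs_nonneg (x t ω)) q
    have h3 := Real.rpow_nonneg (abs_nonneg (x u ω)) q
    have h4 := Real.rpow_nonneg (abs_nonneg (x v ω)) q
    simp only [hD]
    rcases max_choice (max |x s ω| |x t ω|) (max |x u ω| |x v ω|) with h | h <;> rw [h]
    · rcases max_choice |x s ω| |x t ω| with h | h <;> rw [h] <;> linarith
    · rcases max_choice |x u ω| |x v ω| with h | h <;> rw [h] <;> linarith
  have i4 := (((hxi s).1.add (hxi t).1).add (hxi u).1).add (hxi v).1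
  have hDi : Integrable (fun ω => D ω ^ q) P := by
    refine i4.mono' (hDm.pow_const q).aestronglyMeasurable (ae_of_all _ fun ω => ?_)
    rw [Real.norm_of_nonneg (Real.rpow_nonneg (hD0 ω) q)]
    exact hDle ω
  have hDM : ∫ ω, D ω ^ q ∂P ≤ 4 * K := by
    have e1 := integral_add (((hxi s).1.add (hxi t).1).add (hxi u).1) (hxi v).1
    have e2 := integral_add ((hxi s).1.add (hxi t).1) (hxi u).1
    have e3 := integral_add (hxi s).1 (hxi t).1
    have e4 := integral_mono hDi i4 hDle
    simp only [Pi.add_apply] at e1 e2 e3 e4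
    rw [e1, e2, e3] at e4
    have := (hxi s).2
    have := (hxi t).2
    have := (hxi u).2
    have := (hxi v).2
    linarith
  exact abs_integral_mul_sub_le_rpow (rowPast_le hX k) (rowFuture_le hX (k + j)) a b hY hZ hD0
    (fun ω => hYD ω _ (d1 ω) (d2 ω) (d3 ω) (d4 ω)) (fun ω => hZD ω _ (d1 ω) (d2 ω) (d3 ω) (d4 ω))
    hab hDi hDM (lagAlpha_nonneg X j) (lagAlpha_le_one X j) fun A B => le_lagAlpha X k j

theorem measurable_extendRow {X : Fin n → Ω → ℝ} (hX : ∀ i, Measurable (X i)) (t : ℕ) :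
    Measurable (extendRow X t) :=
  (stronglyMeasurable_rowPast_extendRow X le_rfl).measurable.mono (rowPast_le hX t) le_rfl

theorem mixingRate_nonneg (X : Fin n → Ω → ℝ) (δ : ℝ) (j : ℕ) : 0 ≤ mixingRate P X δ j :=
  Real.rpow_nonneg (lagAlpha_nonneg X j) _

theorem mixingRate_antitone (X : Fin n → Ω → ℝ) {δ : ℝ} (hδ : 0 < δ) :
    Antitone (mixingRate P X δ) := fun i j hij =>
  Real.rpow_le_rpow (lagAlpha_nonneg X j) (lagAlpha_antitone X hij) (by positivity)

theorem sum_mixingRate_le {X : Fin n → Ω → ℝ} {δ C : ℝ} (hδ : 0 < δ)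
    (hmixing : ∑ j ∈ Finset.Icc 1 (n - 1), rowAlpha P X j ^ (δ / (2 + δ)) ≤ C) (N : ℕ) :
    ∑ j ∈ Finset.range N, mixingRate P X δ j ≤ 1 + C := by
  have h1 : ∑ j ∈ Finset.range N, mixingRate P X δ j ≤
      ∑ j ∈ Finset.range (n - 1 + 1), mixingRate P X δ j := by
    refine (Finset.sum_le_sum_of_subset_of_nonneg
      (Finset.range_mono (le_max_left N (n - 1 + 1)))
      fun j _ _ => mixingRate_nonneg X δ j).trans_eq ?_
    refine (Finset.sum_subset (Finset.range_mono (le_max_right N _)) fun j _ hj => ?_).symm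
    rw [Finset.mem_range] at hj
    rw [mixingRate, lagAlpha, if_neg (by omega), rowAlpha_eq_zero X (by omega),
      Real.zero_rpow (by positivity)]
  refine h1.trans ?_
  rw [sum_range_succ_eq_zero_add_Icc, mixingRate_zero]
  gcongr
  refine le_of_eq_of_le (Finset.sum_congr rfl fun j hj => ?_) hmixing
  have := Finset.mem_Icc.1 hj
  rw [mixingRate, lagAlpha, if_neg (by omega)]

/-- Two factors give the exponent `(1 + δ) / (2 + δ) = δ / (2 + δ) * (1 + 1 / δ)`. The spare factor
`ρ ^ (1 / δ)` makes the tail of the autocovariances small uniformly over rows. -/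
theorem abs_integral_mul_extendRow_le {X : Fin n → Ω → ℝ} {δ K : ℝ} (hX : ∀ i, Measurable (X i))
    (hδ : 0 < δ) (hK : 0 ≤ K) (hmom : ∀ i, Integrable (fun ω => |X i ω| ^ (4 + 2 * δ)) P ∧
      ∫ ω, |X i ω| ^ (4 + 2 * δ) ∂P ≤ K) (hmean : ∀ i, ∫ ω, X i ω ∂P = 0) {s t : ℕ}
    (hst : s ≤ t) :
    |∫ ω, extendRow X s ω * extendRow X t ω ∂P| ≤
      covConst K * (mixingRate P X δ (t - s) * mixingRate P X δ (t - s) ^ (1 / δ)) := by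
  have := abs_cov_extendRow_le hX (by positivity : 0 < 4 + 2 * δ) hK hmom s (t - s) s t s t 1 1
    (by norm_num; linarith) (stronglyMeasurable_rowPast_extendRow X le_rfl)
    (stronglyMeasurable_rowFuture_extendRow X (by omega : s + (t - s) ≤ t))
    (fun ω d h _ _ _ => by simpa using h) (fun ω d _ h _ _ => by simpa using h)
  rw [integral_extendRow hmean s, zero_mul, sub_zero] at this
  convert this using 2
  have h0 := lagAlpha_nonneg (P := P) X (t - s)
  rw [mixingRate, ← Real.rpow_mul h0]
  rw [← Real.rpow_add_of_nonneg h0 (by positivity) (by positivity)]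
  congr 1
  push_cast
  field_simp
  ring

/-- The mixed moments up to order four of a centered row decay at the mixing rate. -/
theorem isMomentMixing_extendRow {X : Fin n → Ω → ℝ} {δ K C : ℝ} (hX : ∀ i, Measurable (X i))
    (hδ : 0 < δ) (hK : 0 ≤ K) (hmom : ∀ i, Integrable (fun ω => |X i ω| ^ (4 + 2 * δ)) P ∧
      ∫ ω, |X i ω| ^ (4 + 2 * δ) ∂P ≤ K) (hmean : ∀ i, ∫ ω, X i ω ∂P = 0)
    (hmixing : ∑ j ∈ Finset.Icc 1 (n - 1), rowAlpha P X j ^ (δ / (2 + δ)) ≤ C) :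
    IsMomentMixing P n (covConst K) (1 + C) (mixingRate P X δ) (extendRow X) where
  measurable := measurable_extendRow hX
  eq_zero t ht ω := by rw [extendRow_of_le X ht]
  integrable_pow t := by
    rcases lt_or_ge t n with ht | ht
    · rw [extendRow_of_lt X ht]
      refine ((integrable_const (1 : ℝ)).add (hmom ⟨t, ht⟩).1).mono'
        ((hX _).pow_const 4).aestronglyMeasurable (ae_of_all _ fun ω => ?_)
      rw [Real.norm_eq_abs, abs_pow, Pi.add_apply]
      rcases le_total |X ⟨t, ht⟩ ω| 1 with h | h
      · have := pow_le_one₀ (abs_nonneg _) h (n := 4)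
        have := Real.rpow_nonneg (abs_nonneg (X ⟨t, ht⟩ ω)) (4 + 2 * δ)
        linarith
      · have : |X ⟨t, ht⟩ ω| ^ 4 ≤ |X ⟨t, ht⟩ ω| ^ (4 + 2 * δ) := by
          rw [← Real.rpow_natCast]
          exact Real.rpow_le_rpow_of_exponent_le h (by push_cast; linarith)
        linarith
    · simp [extendRow_of_le X ht]
  c_nonneg := by unfold covConst; positivity
  rate_nonneg := mixingRate_nonneg X δ
  rate_zero := mixingRate_zero X δ
  rate_antitone := mixingRate_antitone X hδ
  rate_sum := sum_mixingRate_le hδ hmixing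
  moment_two s t hst := by
    refine (abs_integral_mul_extendRow_le hX hδ hK hmom hmean hst).trans ?_
    have h0 := mixingRate_nonneg (P := P) X δ (t - s)
    have h1 : mixingRate P X δ (t - s) ≤ 1 :=
      mixingRate_zero (P := P) X δ ▸ mixingRate_antitone X hδ (Nat.zero_le _)
    refine mul_le_mul_of_nonneg_left ?_ (by unfold covConst; positivity)
    exact mul_le_of_le_one_right h0 (Real.rpow_le_one h0 h1 (by positivity))
  moment_one_three s t u v hst hsu hsv := by
    have h := abs_cov_extendRow_le hX (by positivity : 0 < 4 + 2 * δ) hK hmom s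
      (min t (min u v) - s) s t u v 1 3
      (by norm_num; linarith) (stronglyMeasurable_rowPast_extendRow X le_rfl)
      ((stronglyMeasurable_rowFuture_extendRow X (by omega : s + (min t (min u v) - s) ≤ t)).mul
        ((stronglyMeasurable_rowFuture_extendRow X (by omega)).mul
          (stronglyMeasurable_rowFuture_extendRow X (by omega : _ ≤ v)) :
            StronglyMeasurable[rowFuture X (s + (min t (min u v) - s))]
            (extendRow X u * extendRow X v)))
      (fun ω d h _ _ _ => by simpa using h) (fun ω d _ h1 h2 h3 => by
        have hd : 0 ≤ d := (abs_nonneg _).trans h1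
        simp only [Pi.mul_apply, abs_mul]
        calc _ ≤ d * (d * d) := by gcongr
          _ = d ^ 3 := by ring)
    rw [integral_extendRow hmean s, zero_mul, sub_zero] at h
    -- With four factors Davydov's exponent is exactly the one in the mixing hypothesis.
    have he : 1 - ((1 : ℕ) + (3 : ℕ) : ℝ) / (4 + 2 * δ) = δ / (2 + δ) := by
      push_cast
      field_simp
      ring
    rw [he] at h
    simpa only [Pi.mul_apply, mul_assoc, mixingRate] using h
  cov_two_two s t u v hst htu huv := by
    have h := abs_cov_extendRow_le hX (by positivity : 0 < 4 + 2 * δ) hK hmom t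
      (u - t) s t u v 2 2
      (by norm_num; linarith) ((stronglyMeasurable_rowPast_extendRow X hst).mul
        (stronglyMeasurable_rowPast_extendRow X le_rfl))
      ((stronglyMeasurable_rowFuture_extendRow X (by omega : t + (u - t) ≤ u)).mul
        (stronglyMeasurable_rowFuture_extendRow X (by omega : _ ≤ v)))
      (fun ω d h1 h2 _ _ => by
        have hd : 0 ≤ d := (abs_nonneg _).trans h1
        simp only [Pi.mul_apply, abs_mul, sq]
        gcongr) (fun ω d _ _ h1 h2 => by
        have hd : 0 ≤ d := (abs_nonneg _).trans h1
        simp only [Pi.mul_apply, abs_mul, sq]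
        gcongr)
    have he : 1 - ((2 : ℕ) + (2 : ℕ) : ℝ) / (4 + 2 * δ) = δ / (2 + δ) := by
      push_cast
      field_simp
      ring
    rw [he] at h
    simpa only [Pi.mul_apply, mixingRate] using h

end RowMixing

/-! ### Bias with respect to the long-run variance. -/

section LongRunVariance

variable {Ω : Type*} [MeasurableSpace Ω] {P : Measure Ω} {n : ℕ}

theorem integral_mul_extendRow_eq {X : Fin n → Ω → ℝ} (hstat : IsStrictlyStationaryRow P X)
    {i j : ℕ} (hij : j + i < n) :
    ∫ ω, extendRow X j ω * extendRow X (j + i) ω ∂P =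
      ∫ ω, extendRow X 0 ω * extendRow X i ω ∂P := by
  have hid := hstat (i + 1) j (by omega)
  have hu : Measurable fun v : Fin (i + 1) → ℝ => v 0 * v (Fin.last i) := by fun_prop
  have := (hid.comp hu).integral_eq
  rw [extendRow_of_lt X (by omega : j < n), extendRow_of_lt X hij,
    extendRow_of_lt X (by omega : 0 < n), extendRow_of_lt X (by omega : i < n)]
  simp only [Function.comp_def, Fin.val_zero, Fin.val_last, zero_add] at this
  rw [this]
  simp only [add_comm i j]

theorem rowLongRunVariance_eq_sum {X : Fin n → Ω → ℝ} (hX : ∀ i, Measurable (X i))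
    (hmean : ∀ i, ∫ ω, X i ω ∂P = 0) (hn : 0 < n) :
    rowLongRunVariance P X = ∑ i ∈ Finset.range n,
      lagWeight i * ∫ ω, extendRow X 0 ω * extendRow X i ω ∂P := by
  obtain ⟨m, rfl⟩ : ∃ m, n = m + 1 := ⟨n - 1, by omega⟩
  rw [rowLongRunVariance, dif_pos hn, sum_range_succ_eq_zero_add_Icc]
  congr 1
  · rw [variance_eq_integral (hX _).aemeasurable, hmean]
    simp [lagWeight, extendRow_of_lt X hn, sq]
  · rw [Finset.mul_sum, ← Finset.Ico_add_one_right_eq_Icc, Finset.sum_Ico_eq_sum_range,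
      ← Fin.sum_univ_eq_sum_range fun i => lagWeight (1 + i) *
        ∫ ω, extendRow X 0 ω * extendRow X (1 + i) ω ∂P]
    refine Finset.sum_congr rfl fun i _ => ?_
    have hi : 1 + (i : ℕ) < m + 1 := by have := i.isLt; omega
    rw [covariance, hmean, hmean, extendRow_of_lt X hn, extendRow_of_lt X hi]
    simp [lagWeight]

variable [IsProbabilityMeasure P]

theorem integral_lagProductSum_extendRow {X : Fin n → Ω → ℝ} {c R : ℝ} {ρ : ℕ → ℝ}
    (H : IsMomentMixing P n c R ρ (extendRow X)) (hstat : IsStrictlyStationaryRow P X) (B : ℕ) :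
    ∫ ω, lagProductSum n B (fun t => extendRow X t ω) ∂P =
      (1 / (n : ℝ)) * ∑ i ∈ Finset.range (B + 1), ((n - i : ℕ) : ℝ) *
        (lagWeight i * ∫ ω, extendRow X 0 ω * extendRow X i ω ∂P) := by
  simp only [lagProductSum]
  rw [integral_const_mul, integral_finsetSum _ fun p _ => (H.integrable_two _ _).const_mul _,
    Finset.sum_product]
  congr 1
  refine Finset.sum_congr rfl fun i _ => ?_
  simp only [integral_const_mul]
  rw [← Finset.sum_subset (Finset.range_mono (Nat.sub_le n i)) fun j _ hj => by
    have hj := mt Finset.mem_range.2 hj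
    simp [extendRow_of_le X (by omega : n ≤ j + i)]]
  rw [Finset.sum_congr rfl fun j hj => by
    rw [integral_mul_extendRow_eq hstat (by have := Finset.mem_range.1 hj; omega)]]
  simp

/-- The last term of an antitone sequence is at most the average. Only `R` enters, so the decay is
uniform over rows, which summability row by row would not give. -/
theorem rate_le_div {ρ : ℕ → ℝ} {R : ℝ} (hρ : Antitone ρ)
    (hR : ∀ N, ∑ j ∈ Finset.range N, ρ j ≤ R) (i : ℕ) : ρ i ≤ R / (i + 1) := by
  rw [le_div_iff₀ (by positivity)]
  calc ρ i * (i + 1) = ∑ _j ∈ Finset.range (i + 1), ρ i := by simp; ring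
    _ ≤ ∑ j ∈ Finset.range (i + 1), ρ j :=
        Finset.sum_le_sum fun j hj => hρ (by have := Finset.mem_range.1 hj; omega)
    _ ≤ R := hR _

/-- The bias of the estimator with truncation `B`. -/
theorem abs_integral_lagProductSum_sub_rowLongRunVariance_le {X : Fin n → Ω → ℝ} {δ K C : ℝ}
    (hX : ∀ i, Measurable (X i)) (hδ : 0 < δ) (hK : 0 ≤ K)
    (hmom : ∀ i, Integrable (fun ω => |X i ω| ^ (4 + 2 * δ)) P ∧
      ∫ ω, |X i ω| ^ (4 + 2 * δ) ∂P ≤ K) (hmean : ∀ i, ∫ ω, X i ω ∂P = 0)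
    (hmixing : ∑ j ∈ Finset.Icc 1 (n - 1), rowAlpha P X j ^ (δ / (2 + δ)) ≤ C)
    (hstat : IsStrictlyStationaryRow P X) {B : ℕ} (hB : B < n) :
    |∫ ω, lagProductSum n B (fun t => extendRow X t ω) ∂P - rowLongRunVariance P X| ≤
      2 * covConst K * (1 + C) * (B / n) +
        2 * covConst K * (1 + C) * ((1 + C) / (B + 1)) ^ (1 / δ) := by
  have H := isMomentMixing_extendRow hX hδ hK hmom hmean hmixing
  have hn : 0 < n := by omega
  have hn' : (0 : ℝ) < n := by exact_mod_cast hn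
  have hR := H.R_nonneg
  have hc := H.c_nonneg
  rw [integral_lagProductSum_extendRow H hstat, rowLongRunVariance_eq_sum hX hmean hn]
  set c := covConst K
  set R := 1 + C
  set γ : ℕ → ℝ := fun i => ∫ ω, extendRow X 0 ω * extendRow X i ω ∂P with hγ
  set ρ := mixingRate P X δ with hρ
  have hγ1 : ∀ i, |γ i| ≤ c * ρ i := fun i => by
    simpa using H.moment_two 0 i (Nat.zero_le i)
  have hγ2 : ∀ i, |γ i| ≤ c * (ρ i * ρ i ^ (1 / δ)) := fun i => by
    simpa using abs_integral_mul_extendRow_le hX hδ hK hmom hmean (Nat.zero_le i)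
  have hsplit : ∑ i ∈ Finset.range n, lagWeight i * γ i =
      ∑ i ∈ Finset.range (B + 1), lagWeight i * γ i +
        ∑ i ∈ Finset.Ico (B + 1) n, lagWeight i * γ i :=
    (Finset.sum_range_add_sum_Ico _ (by omega)).symm
  have hw : ∀ i, |lagWeight i * γ i| ≤ 2 * |γ i| := fun i => by
    rw [abs_mul, abs_of_nonneg (lagWeight_nonneg i)]
    exact mul_le_mul_of_nonneg_right (lagWeight_le i) (abs_nonneg _)
  have hhead : |(1 / (n : ℝ)) * ∑ i ∈ Finset.range (B + 1), ((n - i : ℕ) : ℝ) *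
      (lagWeight i * γ i) - ∑ i ∈ Finset.range (B + 1), lagWeight i * γ i| ≤
      2 * c * R * (B / n) := by
    rw [Finset.mul_sum, ← Finset.sum_sub_distrib]
    refine (Finset.abs_sum_le_sum_abs _ _).trans ?_
    calc _ ≤ ∑ i ∈ Finset.range (B + 1), (B / n : ℝ) * (2 * (c * ρ i)) := by
          refine Finset.sum_le_sum fun i hi => ?_
          have hi := Finset.mem_range.1 hi
          -- Lag `i` has only `n - i` products, a relative loss of `i / n ≤ B / n`.
          have e : 1 / (n : ℝ) * (((n - i : ℕ) : ℝ) * (lagWeight i * γ i)) - lagWeight i * γ i =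
              -((i : ℝ) / n * (lagWeight i * γ i)) := by
            rw [Nat.cast_sub (by omega)]; field_simp; ring
          rw [e, abs_neg, abs_mul, abs_of_nonneg (by positivity : 0 ≤ (i : ℝ) / n)]
          have hiB : (i : ℝ) ≤ B := by exact_mod_cast Nat.lt_succ_iff.1 hi
          have := hγ1 i
          refine mul_le_mul (by gcongr) ((hw i).trans (by linarith)) (abs_nonneg _) (by positivity)
      _ = (B / n : ℝ) * (2 * c) * ∑ i ∈ Finset.range (B + 1), ρ i := by
          rw [Finset.mul_sum]; exact Finset.sum_congr rfl fun i _ => by ring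
      _ ≤ (B / n : ℝ) * (2 * c) * R := by
          refine mul_le_mul_of_nonneg_left (H.rate_sum _) (by positivity)
      _ = _ := by ring
  have htail : |∑ i ∈ Finset.Ico (B + 1) n, lagWeight i * γ i| ≤
      2 * c * R * (R / (B + 1)) ^ (1 / δ) := by
    refine (Finset.abs_sum_le_sum_abs _ _).trans ?_
    -- One factor `ρ i` is kept for summation; the spare power is replaced by its bound at lag `B`.
    calc _ ≤ ∑ i ∈ Finset.Ico (B + 1) n, 2 * c * (R / (B + 1)) ^ (1 / δ) * ρ i := by
          refine Finset.sum_le_sum fun i hi => ?_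
          have hi := Finset.mem_Ico.1 hi
          have hr0 : 0 ≤ ρ i := H.rate_nonneg i
          have hr : ρ i ≤ R / (B + 1) :=
            (H.rate_antitone (by omega : B ≤ i)).trans (rate_le_div H.rate_antitone H.rate_sum B)
          have hr' : ρ i ^ (1 / δ) ≤ (R / (B + 1)) ^ (1 / δ) :=
            Real.rpow_le_rpow hr0 hr (by positivity)
          calc _ ≤ 2 * |γ i| := hw i
            _ ≤ 2 * (c * (ρ i * ρ i ^ (1 / δ))) := by gcongr; exact hγ2 i
            _ ≤ 2 * (c * (ρ i * (R / (B + 1)) ^ (1 / δ))) := by gcongr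
            _ = _ := by ring
      _ = 2 * c * (R / (B + 1)) ^ (1 / δ) * ∑ i ∈ Finset.Ico (B + 1) n, ρ i := by
          rw [Finset.mul_sum]
      _ ≤ 2 * c * (R / (B + 1)) ^ (1 / δ) * R := by
          refine mul_le_mul_of_nonneg_left ?_ (by positivity)
          refine le_trans ?_ (H.rate_sum n)
          refine Finset.sum_le_sum_of_subset_of_nonneg ?_ fun i _ _ => H.rate_nonneg i
          intro i hi
          exact Finset.mem_range.2 (Finset.mem_Ico.1 hi).2
      _ = _ := by ring
  rw [hsplit]
  rw [abs_le] at *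
  constructor <;> linarith

end LongRunVariance

/-! ### Passage to the limit for the original row, and the sample variance. -/

section Limits

variable {Ω : Type*} [MeasurableSpace Ω] {P : Measure Ω} [IsProbabilityMeasure P]

/-- The shift by `N` is needed because integrability of the estimators is established only from some
index on. -/
theorem tendstoInMeasure_of_tendsto_integral_abs_sub {f : ℕ → Ω → ℝ} {a : ℝ} (N : ℕ)
    (hf : ∀ n, N ≤ n → Integrable (f n) P)
    (h : Tendsto (fun n => ∫ ω, |f n ω - a| ∂P) atTop (𝓝 0)) :
    TendstoInMeasure P f atTop fun _ => a := by
  have hf' : ∀ n, Integrable (f (n + N)) P := fun n => hf _ (Nat.le_add_left N n)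
  have key : TendstoInMeasure P (fun n => f (n + N)) atTop fun _ => a := by
    refine tendstoInMeasure_of_tendsto_eLpNorm (p := 1) one_ne_zero
      (fun n => (hf' n).aestronglyMeasurable) aestronglyMeasurable_const ?_
    have e : ∀ n, eLpNorm (f (n + N) - fun _ => a) 1 P =
        ENNReal.ofReal (∫ ω, |f (n + N) ω - a| ∂P) := by
      intro n
      have hi : Integrable (f (n + N) - fun _ => a) P := (hf' n).sub (integrable_const a)
      rw [eLpNorm_one_eq_lintegral_enorm, ← ofReal_integral_norm_eq_lintegral_enorm hi]
      rfl
    simp_rw [e]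
    simpa using ENNReal.tendsto_ofReal ((tendsto_add_atTop_iff_nat N).2 h)
  exact fun ε hε => (tendsto_add_atTop_iff_nat N).1 (key ε hε)

theorem tendsto_floor_add_one_div_sqrt {b : ℕ → ℝ} (hb : Tendsto b atTop atTop)
    (hb_small : b =o[atTop] fun n : ℕ => √(n : ℝ)) :
    Tendsto (fun n : ℕ => ((⌊b n⌋₊ : ℝ) + 1) / √(n : ℝ)) atTop (𝓝 0) := by
  have hs : Tendsto (fun n : ℕ => √(n : ℝ)) atTop atTop :=
    Real.tendsto_sqrt_atTop.comp tendsto_natCast_atTop_atTop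
  have h1 : Tendsto (fun n : ℕ => b n / √(n : ℝ) + 1 / √(n : ℝ)) atTop (𝓝 0) := by
    have := hb_small.tendsto_div_nhds_zero.add (hs.const_div_atTop 1)
    simpa using this
  refine squeeze_zero' (Eventually.of_forall fun n => by positivity) ?_ h1
  filter_upwards [hb.eventually_ge_atTop 0] with n hn
  rw [← add_div]
  gcongr
  exact Nat.floor_le hn

theorem tendsto_integral_abs_tauHatSq_sub {X : (n : ℕ) → Fin n → Ω → ℝ} {δ K C τ : ℝ}
    {b : ℕ → ℝ} (hδ : 0 < δ) (hK : 0 ≤ K) (hC : 0 ≤ C) (hmeas : ∀ n i, Measurable (X n i))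
    (hstat : ∀ n, IsStrictlyStationaryRow P (X n))
    (hmoment : ∀ n i, Integrable (fun ω => |X n i ω| ^ (4 + 2 * δ)) P ∧
      ∫ ω, |X n i ω| ^ (4 + 2 * δ) ∂P ≤ K)
    (hmean : ∀ n i, ∫ ω, X n i ω ∂P = 0)
    (hmixing : ∀ n, ∑ j ∈ Finset.Icc 1 (n - 1), rowAlpha P (X n) j ^ (δ / (2 + δ)) ≤ C)
    (hlongrun : Tendsto (fun n => rowLongRunVariance P (X n)) atTop (𝓝 τ))
    (hb : Tendsto b atTop atTop) (hb_small : b =o[atTop] fun n : ℕ => √(n : ℝ)) :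
    Tendsto (fun n => ∫ ω, |tauHatSq (b n) (fun i => X n i ω) - τ| ∂P) atTop (𝓝 0) := by
  have hBs := tendsto_floor_add_one_div_sqrt hb hb_small
  have hBtop : Tendsto (fun n => (⌊b n⌋₊ : ℝ) + 1) atTop atTop :=
    tendsto_atTop_add_const_right _ _
      (tendsto_natCast_atTop_atTop.comp (tendsto_nat_floor_atTop.comp hb))
  -- This yields `⌊b n⌋₊ < n`, which the bias bound requires.
  have hBn : ∀ᶠ n : ℕ in atTop, (⌊b n⌋₊ : ℝ) + 1 ≤ √(n : ℝ) := by
    filter_upwards [hBs.eventually_le_const (zero_lt_one), eventually_gt_atTop 0] with n h hn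
    have : 0 < √(n : ℝ) := Real.sqrt_pos.2 (by exact_mod_cast hn)
    rwa [div_le_one this] at h
  set c := covConst K
  set R := 1 + C
  have hlim : Tendsto (fun n : ℕ =>
      (12 * c * R + 8 * (c + c ^ 2) * R + 1) * (((⌊b n⌋₊ : ℝ) + 1) / √(n : ℝ)) +
      (2 * c * R * (((⌊b n⌋₊ : ℝ) + 1) / √(n : ℝ)) +
        2 * c * R * (R / ((⌊b n⌋₊ : ℝ) + 1)) ^ (1 / δ)) +
      |rowLongRunVariance P (X n) - τ|) atTop (𝓝 0) := by
    have h1 := hBs.const_mul (12 * c * R + 8 * (c + c ^ 2) * R + 1)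
    have h2 := hBs.const_mul (2 * c * R)
    have h3 : Tendsto (fun n => (R / ((⌊b n⌋₊ : ℝ) + 1)) ^ (1 / δ)) atTop (𝓝 0) := by
      have := (hBtop.const_div_atTop R).rpow_const (p := 1 / δ) (Or.inr (by positivity))
      rwa [Real.zero_rpow (by positivity)] at this
    have h4 := h3.const_mul (2 * c * R)
    have h5 : Tendsto (fun n => |rowLongRunVariance P (X n) - τ|) atTop (𝓝 0) := by
      have := (hlongrun.sub_const τ).abs
      simpa using this
    have := (h1.add (h2.add h4)).add h5
    simpa using this
  refine squeeze_zero' (Eventually.of_forall fun n => integral_nonneg fun ω => abs_nonneg _) ?_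
    hlim
  filter_upwards [hBn, eventually_gt_atTop 0] with n hBn hn
  have hn1 : (1 : ℝ) ≤ n := by exact_mod_cast hn
  have hs : 0 < √(n : ℝ) := Real.sqrt_pos.2 (by linarith)
  have hsn : √(n : ℝ) ≤ n := by
    rw [Real.sqrt_le_left (by positivity)]
    nlinarith
  have hBlt : ⌊b n⌋₊ < n := by
    have : (⌊b n⌋₊ : ℝ) + 1 ≤ n := hBn.trans hsn
    exact_mod_cast this
  have H := isMomentMixing_extendRow (hmeas n) hδ hK (hmoment n) (hmean n) (hmixing n)
  have hc : 0 ≤ c := H.c_nonneg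
  obtain ⟨hi, hle⟩ := H.integral_abs_tauHatSq_sub_le hn (b n)
  have hbias := abs_integral_lagProductSum_sub_rowLongRunVariance_le (hmeas n) hδ hK (hmoment n)
    (hmean n) (hmixing n) (hstat n) hBlt
  have hdiv : (⌊b n⌋₊ : ℝ) / n ≤ ((⌊b n⌋₊ : ℝ) + 1) / √(n : ℝ) := by
    gcongr
    linarith
  have hdiv' : 2 * c * R * ((⌊b n⌋₊ : ℝ) / n) ≤ 2 * c * R * (((⌊b n⌋₊ : ℝ) + 1) / √(n : ℝ)) := by
    gcongr
  simp_rw [tauHatSq_extendRow (X n)]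
  set e := ∫ ω', lagProductSum n ⌊b n⌋₊ (fun t => extendRow (X n) t ω') ∂P
  set v := rowLongRunVariance P (X n)
  calc _ ≤ ∫ ω, (|tauHatSq (b n) (fun i : Fin n => extendRow (X n) i ω) - e| +
        (|e - v| + |v - τ|)) ∂P := by
        refine integral_mono (hi.sub (integrable_const τ)).abs
          ((hi.sub (integrable_const e)).abs.add (integrable_const _)) fun ω => ?_
        have h1 := abs_sub_le (tauHatSq (b n) fun i : Fin n => extendRow (X n) i ω) e τ
        have h2 := abs_sub_le e v τ
        simp only
        linarith
    _ = ∫ ω, |tauHatSq (b n) (fun i : Fin n => extendRow (X n) i ω) - e| ∂P +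
        (|e - v| + |v - τ|) := by
        have h1 := integral_add (hi.sub (integrable_const e)).abs
          (integrable_const (|e - v| + |v - τ|))
        simp only [Pi.sub_apply] at h1
        rw [h1]
        simp
    _ ≤ _ := by linarith

/-- The sample variance of a row is close in `L¹` to the common variance of its entries. -/
theorem integral_abs_sampleVariance_sub_le {n : ℕ} {X : Fin n → Ω → ℝ} {c R σ : ℝ} {ρ : ℕ → ℝ}
    (hX : ∀ i, Measurable (X i)) (H : IsMomentMixing P n c R ρ (extendRow X))
    (hstat : IsStrictlyStationaryRow P X)
    (hmean : ∀ i, ∫ ω, X i ω ∂P = 0) (hvar : ∀ i, Var[X i; P] = σ) (hn : 0 < n) :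
    ∫ ω, |tauHatSq 0 (fun i => X i ω) - σ| ∂P ≤
      (12 * c * R + 8 * (c + c ^ 2) * R + 1) * (1 / √n) := by
  have hn' : (n : ℝ) ≠ 0 := by exact_mod_cast hn.ne'
  have h := (H.integral_abs_tauHatSq_sub_le hn 0).2
  -- With truncation `0` only lag `0` survives, so there is no bias.
  have e : ∫ ω, lagProductSum n ⌊(0 : ℝ)⌋₊ (fun t => extendRow X t ω) ∂P = σ := by
    rw [integral_lagProductSum_extendRow H hstat, Nat.floor_zero, ← hvar ⟨0, hn⟩,
      variance_eq_integral (hX _).aemeasurable, hmean]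
    simp [lagWeight, extendRow_of_lt X hn, sq, hn']
  rw [e] at h
  simpa only [tauHatSq_extendRow X, Nat.floor_zero, Nat.cast_zero, zero_add] using h

end Limits

/-! ### Exchangeability of the permuted deviations and their fourth moments. -/

section RandomPermutation

variable {n : ℕ}

theorem map_mul_right_uniformOn_perm (τ : Equiv.Perm (Fin n)) :
    (uniformOn (Set.univ : Set (Equiv.Perm (Fin n)))).map (fun π => π * τ) =
      uniformOn Set.univ := by
  refine Measure.ext_of_singleton fun π => ?_
  rw [Measure.map_apply (measurable_of_countable _) (MeasurableSet.singleton _)]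
  have : (fun π => π * τ) ⁻¹' {π} = {π * τ⁻¹} := by
    ext π'
    simp [eq_mul_inv_iff_mul_eq]
  rw [this, uniformOn_univ, uniformOn_univ, Measure.count_singleton, Measure.count_singleton]

/-- The deviation from the sample mean of the `i`-th entry of the permuted vector `y`. -/
noncomputable def permDeviation (i : Fin n) (p : Equiv.Perm (Fin n) × (Fin n → ℝ)) : ℝ :=
  p.2 (p.1 i) - sampleMean p.2

theorem measurable_permDeviation (i : Fin n) : Measurable (permDeviation i) := by
  refine measurable_from_prod_countable_right fun π => ?_
  change Measurable fun y : Fin n → ℝ => y (π i) - 1 / (n : ℝ) * ∑ j, y j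
  fun_prop

theorem sampleMean_comp_perm (π : Equiv.Perm (Fin n)) (y : Fin n → ℝ) :
    (sampleMean fun i => y (π i)) = sampleMean y := by
  rw [sampleMean, sampleMean, Equiv.sum_comp π y]

theorem sum_permDeviation (p : Equiv.Perm (Fin n) × (Fin n → ℝ)) :
    ∑ i, permDeviation i p = 0 := by
  simp only [permDeviation]
  rw [Finset.sum_sub_distrib, Equiv.sum_comp p.1 p.2, sampleMean]
  rcases Nat.eq_zero_or_pos n with rfl | hn
  · simp
  · have : (n : ℝ) ≠ 0 := by exact_mod_cast hn.ne'
    simp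
    field_simp
    ring

theorem sub_pow_four_le (a b : ℝ) : (a - b) ^ 4 ≤ 8 * (a ^ 4 + b ^ 4) := by
  have h1 : (a - b) ^ 2 ≤ 2 * (a ^ 2 + b ^ 2) := by nlinarith [sq_nonneg (a + b)]
  calc (a - b) ^ 4 = ((a - b) ^ 2) ^ 2 := by ring
    _ ≤ (2 * (a ^ 2 + b ^ 2)) ^ 2 := pow_le_pow_left₀ (sq_nonneg _) h1 2
    _ ≤ _ := by nlinarith [sq_nonneg (a ^ 2 - b ^ 2)]

/-- Cauchy–Schwarz twice, a discrete Jensen inequality for the fourth power. -/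
theorem mul_sampleMean_pow_four_le (y : Fin n → ℝ) :
    n * sampleMean y ^ 4 ≤ ∑ i, y i ^ 4 := by
  rcases Nat.eq_zero_or_pos n with rfl | hn
  · simp
  have hn' : (0 : ℝ) < n := by exact_mod_cast hn
  have h1 : (∑ i, y i) ^ 2 ≤ n * ∑ i, y i ^ 2 := by
    simpa using sq_sum_le_card_mul_sum_sq (s := Finset.univ) (f := y)
  have h2 : (∑ i, y i ^ 2) ^ 2 ≤ n * ∑ i, (y i ^ 2) ^ 2 := by
    simpa using sq_sum_le_card_mul_sum_sq (s := Finset.univ) (f := fun i => y i ^ 2)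
  have h3 : (∑ i, y i) ^ 4 ≤ n ^ 3 * ∑ i, y i ^ 4 := by
    calc (∑ i, y i) ^ 4 = ((∑ i, y i) ^ 2) ^ 2 := by ring
      _ ≤ (n * ∑ i, y i ^ 2) ^ 2 := pow_le_pow_left₀ (sq_nonneg _) h1 2
      _ = n ^ 2 * (∑ i, y i ^ 2) ^ 2 := by ring
      _ ≤ n ^ 2 * (n * ∑ i, (y i ^ 2) ^ 2) := by gcongr
      _ = n ^ 3 * ∑ i, y i ^ 4 := by simp only [← pow_mul]; ring
  calc n * sampleMean y ^ 4 = (∑ i, y i) ^ 4 / n ^ 3 := by rw [sampleMean]; field_simp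
    _ ≤ _ := by rw [div_le_iff₀ (by positivity)]; linarith

theorem sum_permDeviation_pow_four_le (p : Equiv.Perm (Fin n) × (Fin n → ℝ)) :
    ∑ i, permDeviation i p ^ 4 ≤ 16 * ∑ i, p.2 i ^ 4 := by
  simp only [permDeviation]
  rw [Equiv.sum_comp p.1 fun i => (p.2 i - sampleMean p.2) ^ 4]
  calc _ ≤ ∑ i, 8 * (p.2 i ^ 4 + sampleMean p.2 ^ 4) :=
        Finset.sum_le_sum fun i _ => sub_pow_four_le _ _
    _ = 8 * (∑ i, p.2 i ^ 4 + n * sampleMean p.2 ^ 4) := by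
        rw [← Finset.mul_sum, Finset.sum_add_distrib]; simp
    _ ≤ _ := by have := mul_sampleMean_pow_four_le p.2; linarith

variable {Ω : Type*} [MeasurableSpace Ω] {P : Measure Ω}

/-- By independence both joint laws are products with the same second factor, and right
multiplication preserves the uniform first factor. -/
theorem identDistrib_perm_mul [IsProbabilityMeasure P]
    {perm : Ω → Equiv.Perm (Fin n)} {Y : Ω → Fin n → ℝ}
    (hperm : Measurable perm) (hY : Measurable Y) (hunif : P.map perm = uniformOn Set.univ)
    (hind : IndepFun perm Y P) (τ : Equiv.Perm (Fin n)) :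
    IdentDistrib (fun ω => (perm ω * τ, Y ω)) (fun ω => (perm ω, Y ω)) P P where
  aemeasurable_fst := (((measurable_of_countable fun π : Equiv.Perm (Fin n) => π * τ).comp
    hperm).prodMk hY).aemeasurable
  aemeasurable_snd := (hperm.prodMk hY).aemeasurable
  map_eq := by
    have hmul : Measurable fun π : Equiv.Perm (Fin n) => π * τ := measurable_of_countable _
    have h1 := (indepFun_iff_map_prod_eq_prod_map_map hperm.aemeasurable hY.aemeasurable).1 hind
    have hind' : IndepFun (fun ω => perm ω * τ) Y P := hind.comp hmul measurable_id
    have h2 := (indepFun_iff_map_prod_eq_prod_map_map (hmul.comp hperm).aemeasurable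
      hY.aemeasurable).1 hind'
    have h3 : P.map (fun ω => perm ω * τ) = P.map perm := by
      rw [hunif, ← map_mul_right_uniformOn_perm τ, ← hunif, Measure.map_map hmul hperm]
      rfl
    rw [h1, ← h3]
    exact h2

/-- The deviations of a uniformly permuted vector from the sample mean are exchangeable. -/
theorem integral_permDeviation_exchange [IsProbabilityMeasure P]
    {perm : Ω → Equiv.Perm (Fin n)} {Y : Ω → Fin n → ℝ}
    (hperm : Measurable perm) (hY : Measurable Y) (hunif : P.map perm = uniformOn Set.univ)
    (hind : IndepFun perm Y P) (τ : Equiv.Perm (Fin n)) (a b c d : Fin n) :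
    ∫ ω, permDeviation (τ a) (perm ω, Y ω) * permDeviation (τ b) (perm ω, Y ω) *
        (permDeviation (τ c) (perm ω, Y ω) * permDeviation (τ d) (perm ω, Y ω)) ∂P =
      ∫ ω, permDeviation a (perm ω, Y ω) * permDeviation b (perm ω, Y ω) *
        (permDeviation c (perm ω, Y ω) * permDeviation d (perm ω, Y ω)) ∂P := by
  have hu : Measurable fun p : Equiv.Perm (Fin n) × (Fin n → ℝ) =>
      permDeviation a p * permDeviation b p * (permDeviation c p * permDeviation d p) :=
    ((measurable_permDeviation a).mul (measurable_permDeviation b)).mul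
      ((measurable_permDeviation c).mul (measurable_permDeviation d))
  -- The deviation at `τ a` under `π` is by definition the deviation at `a` under `π * τ`.
  exact ((identDistrib_perm_mul hperm hY hunif hind τ).comp hu).integral_eq

/-- An exchangeable vector that sums to zero, through its fourth moments. -/
structure IsCenteredExchangeable (P : Measure Ω) (M : ℝ) (z : Fin n → Ω → ℝ) : Prop where
  measurable : ∀ i, Measurable (z i)
  integrable_pow : ∀ i, Integrable (fun ω => z i ω ^ 4) P
  sum_eq_zero : ∀ ω, ∑ i, z i ω = 0
  exchange : ∀ (τ : Equiv.Perm (Fin n)) (a b c d : Fin n),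
    ∫ ω, z (τ a) ω * z (τ b) ω * (z (τ c) ω * z (τ d) ω) ∂P =
      ∫ ω, z a ω * z b ω * (z c ω * z d ω) ∂P
  integral_sum_pow_le : ∫ ω, ∑ i, z i ω ^ 4 ∂P ≤ M * n

theorem isCenteredExchangeable_permDeviation [IsProbabilityMeasure P]
    {perm : Ω → Equiv.Perm (Fin n)} {Y : Ω → Fin n → ℝ} {M : ℝ} (hperm : Measurable perm) (hY : Measurable Y)
    (hunif : P.map perm = uniformOn Set.univ) (hind : IndepFun perm Y P)
    (hint : ∀ i, Integrable (fun ω => Y ω i ^ 4) P) (hM : ∀ i, ∫ ω, Y ω i ^ 4 ∂P ≤ M) :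
    IsCenteredExchangeable P (16 * M) fun i ω => permDeviation i (perm ω, Y ω) := by
  have hm : ∀ i, Measurable fun ω => permDeviation i (perm ω, Y ω) := fun i =>
    (measurable_permDeviation i).comp (hperm.prodMk hY)
  have hsum : Integrable (fun ω => 16 * ∑ i, Y ω i ^ 4) P :=
    (integrable_finsetSum _ fun i _ => hint i).const_mul _
  have hle : ∀ ω, ∑ i, permDeviation i (perm ω, Y ω) ^ 4 ≤ 16 * ∑ i, Y ω i ^ 4 :=
    fun ω => sum_permDeviation_pow_four_le _
  have hpow : ∀ i, Integrable (fun ω => permDeviation i (perm ω, Y ω) ^ 4) P := fun i =>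
    hsum.mono' ((hm i).pow_const 4).aestronglyMeasurable (ae_of_all _ fun ω => by
      rw [Real.norm_of_nonneg (by positivity)]
      refine le_trans ?_ (hle ω)
      exact Finset.single_le_sum (f := fun i => permDeviation i (perm ω, Y ω) ^ 4)
        (fun i _ => by positivity) (Finset.mem_univ i))
  refine ⟨hm, hpow, fun ω => sum_permDeviation _,
    fun τ => integral_permDeviation_exchange hperm hY hunif hind τ, ?_⟩
  calc _ ≤ ∫ ω, 16 * ∑ i, Y ω i ^ 4 ∂P :=
        integral_mono (integrable_finsetSum _ fun i _ => hpow i) hsum hle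
    _ = 16 * ∑ i, ∫ ω, Y ω i ^ 4 ∂P := by
        rw [integral_const_mul, integral_finsetSum _ fun i _ => hint i]
    _ ≤ 16 * ∑ _i : Fin n, M := by gcongr with i; exact hM i
    _ = _ := by simp; ring

namespace IsCenteredExchangeable

variable {M : ℝ} {z : Fin n → Ω → ℝ}

theorem integrable_four (H : IsCenteredExchangeable P M z) (a b c d : Fin n) :
    Integrable (fun ω => z a ω * z b ω * (z c ω * z d ω)) P :=
  integrable_mul_mul_mul (H.measurable a) (H.measurable b) (H.measurable c) (H.measurable d)
    (H.integrable_pow a) (H.integrable_pow b) (H.integrable_pow c) (H.integrable_pow d)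

theorem integral_pow_four_le (H : IsCenteredExchangeable P M z) (i : Fin n) :
    ∫ ω, z i ω ^ 4 ∂P ≤ M := by
  have hn : (0 : ℝ) < n := by
    have := i.pos
    exact_mod_cast this
  have heq : ∀ k, ∫ ω, z k ω ^ 4 ∂P = ∫ ω, z i ω ^ 4 ∂P := by
    intro k
    have := H.exchange (Equiv.swap i k) i i i i
    simp only [Equiv.swap_apply_left] at this
    convert this using 3 <;> ring
  have := H.integral_sum_pow_le
  rw [integral_finsetSum _ fun k _ => H.integrable_pow k, Finset.sum_congr rfl fun k _ => heq k]
    at this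
  simp only [Finset.sum_const, Finset.card_univ, Fintype.card_fin, nsmul_eq_mul] at this
  rw [mul_comm M] at this
  exact le_of_mul_le_mul_left this hn

theorem abs_integral_four_le (H : IsCenteredExchangeable P M z) (a b c d : Fin n) :
    |∫ ω, z a ω * z b ω * (z c ω * z d ω) ∂P| ≤ 4 * M := by
  have h := H.integrable_pow
  have e1 := integral_add (((h a).add (h b)).add (h c)) (h d)
  have e2 := integral_add ((h a).add (h b)) (h c)
  have e3 := integral_add (h a) (h b)
  simp only [Pi.add_apply] at e1 e2 e3
  calc _ ≤ ∫ ω, |z a ω * z b ω * (z c ω * z d ω)| ∂P := abs_integral_le_integral_abs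
    _ ≤ ∫ ω, (z a ω ^ 4 + z b ω ^ 4 + z c ω ^ 4 + z d ω ^ 4) ∂P :=
        integral_mono (H.integrable_four a b c d).abs
          ((((h a).add (h b)).add (h c)).add (h d)) fun ω => abs_mul_mul_mul_le _ _ _ _
    _ ≤ 4 * M := by
        rw [e1, e2, e3]
        have := H.integral_pow_four_le a
        have := H.integral_pow_four_le b
        have := H.integral_pow_four_le c
        have := H.integral_pow_four_le d
        linarith

/-- Mixed moments of four distinct entries are of order `1 / n`. -/
theorem abs_integral_four_le_of_distinct (H : IsCenteredExchangeable P M z) (hn : 4 ≤ n)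
    {a b c d : Fin n} (hab : a ≠ b) (hac : a ≠ c) (hbc : b ≠ c) (had : d ≠ a) (hbd : d ≠ b)
    (hcd : d ≠ c) :
    |∫ ω, z a ω * z b ω * (z c ω * z d ω) ∂P| ≤ 12 * M / (n - 3) := by
  have hn' : (0 : ℝ) < n - 3 := by
    have : (4 : ℝ) ≤ n := by exact_mod_cast hn
    linarith
  set I : Fin n → ℝ := fun k => ∫ ω, z a ω * z b ω * (z c ω * z k ω) ∂P with hI
  -- The zero sum is applied to the fourth index. By exchangeability the `n - 3` values off `{a, b,
  -- c}` agree with `I d`, so they balance three terms of size at most `4 * M`.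
  have hsum : ∑ k, I k = 0 := by
    rw [← integral_finsetSum _ fun k _ => H.integrable_four a b c k]
    simp_rw [← Finset.mul_sum, H.sum_eq_zero]
    simp
  have heq : ∀ k ∈ ({a, b, c} : Finset (Fin n))ᶜ, I k = I d := by
    intro k hk
    simp only [Finset.mem_compl, Finset.mem_insert, Finset.mem_singleton, not_or] at hk
    have := H.exchange (Equiv.swap d k) a b c d
    rwa [Equiv.swap_apply_left, Equiv.swap_apply_of_ne_of_ne had.symm (Ne.symm hk.1),
      Equiv.swap_apply_of_ne_of_ne hbd.symm (Ne.symm hk.2.1),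
      Equiv.swap_apply_of_ne_of_ne hcd.symm (Ne.symm hk.2.2)] at this
  have hcard : ({a, b, c} : Finset (Fin n)).card = 3 := Finset.card_eq_three.2
    ⟨a, b, c, hab, hac, hbc, rfl⟩
  have h3 : ∑ k ∈ ({a, b, c} : Finset (Fin n)), I k = I a + I b + I c := by
    rw [Finset.sum_insert (by simp [hab, hac]), Finset.sum_insert (by simp [hbc]),
      Finset.sum_singleton]
    ring
  rw [← Finset.sum_add_sum_compl ({a, b, c} : Finset (Fin n)), h3, Finset.sum_congr rfl heq,
    Finset.sum_const, Finset.card_compl, hcard, Fintype.card_fin, nsmul_eq_mul,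
    Nat.cast_sub (by omega)] at hsum
  have ha := abs_le.1 (H.abs_integral_four_le a b c a)
  have hb := abs_le.1 (H.abs_integral_four_le a b c b)
  have hc := abs_le.1 (H.abs_integral_four_le a b c c)
  change |I d| ≤ _
  rw [le_div_iff₀ hn', ← abs_of_pos hn', ← abs_mul, abs_le]
  push_cast at hsum
  simp only [hI] at ha hb hc hsum ⊢
  constructor <;> linarith

end IsCenteredExchangeable

end RandomPermutation

/-! ### The positive-lag part of the permuted estimator. -/

section PermutedEstimator

variable {n : ℕ}

theorem sum_ite_add_eq_le_one (n a e : ℕ) :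
    ∑ l ∈ Finset.range n, (if l + a = e then (1 : ℝ) else 0) ≤ 1 := by
  rw [Finset.sum_boole]
  have : ((Finset.range n).filter fun l => l + a = e).card ≤ 1 :=
    Finset.card_le_one.2 fun u hu v hv => by
      have := (Finset.mem_filter.1 hu).2
      have := (Finset.mem_filter.1 hv).2
      omega
  exact_mod_cast this

variable {Ω : Type*}

/-- The sum of the lagged products at positive lags. -/
noncomputable def positiveLagSum (n B : ℕ) (y : ℕ → ℝ) : ℝ :=
  ∑ p ∈ Finset.Icc 1 B ×ˢ Finset.range n, y p.2 * y (p.2 + p.1)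

/-- The sample mean and the lag-zero term are symmetric functions of the entries, so the permutation
acts only on the positive lags. -/
theorem tauHatSq_comp_perm (b : ℝ) (π : Equiv.Perm (Fin n)) (y : Fin n → ℝ) :
    tauHatSq b (fun i => y (π i)) = tauHatSq 0 y + 2 / (n : ℝ) *
      positiveLagSum n ⌊b⌋₊ (fun t => extendRow (fun i => permDeviation i) t (π, y)) := by
  have h0 : tauHatSq 0 y = 1 / (n : ℝ) * ∑ i, (y i - sampleMean y) ^ 2 := by
    simp [tauHatSq]
  rw [h0, tauHatSq, sampleMean_comp_perm, Equiv.sum_comp π fun i => (y i - sampleMean y) ^ 2,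
    positiveLagSum, Finset.sum_product]
  congr 2
  refine Finset.sum_congr rfl fun i _ => ?_
  set x : ℕ → ℝ := fun t => extendRow (fun i => permDeviation i) t (π, y) with hx
  rw [← Finset.sum_subset (Finset.range_mono (Nat.sub_le n i)) fun j _ hj => by
    have hj := mt Finset.mem_range.2 hj
    simp [extendRow_of_le (fun i : Fin n => permDeviation i) (by omega : n ≤ j + i)],
    ← Fin.sum_univ_eq_sum_range fun j => x j * x (j + i)]
  refine Finset.sum_congr rfl fun j _ => ?_
  have h1 : (j : ℕ) + i < n := by have := j.isLt; omega
  simp only [hx]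
  rw [extendRow_of_lt _ h1, extendRow_of_lt _ (by omega : (j : ℕ) < n)]
  rfl

variable [MeasurableSpace Ω] {P : Measure Ω}

namespace IsCenteredExchangeable

variable {M : ℝ} {z : Fin n → Ω → ℝ}

theorem integrable_extendRow_four (H : IsCenteredExchangeable P M z) (a b c d : ℕ) :
    Integrable (fun ω => extendRow z a ω * extendRow z b ω *
      (extendRow z c ω * extendRow z d ω)) P := by
  have hm : ∀ t, Measurable (extendRow z t) := measurable_extendRow H.measurable
  have hi : ∀ t, Integrable (fun ω => extendRow z t ω ^ 4) P := by
    intro t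
    rcases lt_or_ge t n with ht | ht
    · rw [extendRow_of_lt z ht]; exact H.integrable_pow _
    · simp [extendRow_of_le z ht]
  exact integrable_mul_mul_mul (hm a) (hm b) (hm c) (hm d) (hi a) (hi b) (hi c) (hi d)

theorem nonneg (H : IsCenteredExchangeable P M z) (hn : 0 < n) : 0 ≤ M :=
  (integral_nonneg fun _ => by positivity).trans (H.integral_pow_four_le ⟨0, hn⟩)

/-- Positive lags keep the two indices of a pair distinct, so coincidences occur only across pairs;
the four indicators list them. Without a coincidence the moment is at most `12 * M / (n - 3)`,
otherwise `4 * M`; outside the row the product is zero. The form `l + 0` matches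
`sum_ite_add_eq_le_one`. -/
theorem abs_integral_lag_products_le (H : IsCenteredExchangeable P M z) (hn : 4 ≤ n)
    {i k : ℕ} (hi : 1 ≤ i) (hk : 1 ≤ k) (j l : ℕ) :
    |∫ ω, extendRow z j ω * extendRow z (j + i) ω *
        (extendRow z l ω * extendRow z (l + k) ω) ∂P| ≤
      4 * M * (3 / (n - 3) + ((if l + 0 = j then 1 else 0) + (if l + k = j then 1 else 0) +
        (if l + 0 = j + i then 1 else 0) + (if l + k = j + i then 1 else 0))) := by
  have hM := H.nonneg (by omega : 0 < n)
  have hn' : (0 : ℝ) < n - 3 := by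
    have : (4 : ℝ) ≤ n := by exact_mod_cast hn
    linarith
  have hq : (0 : ℝ) ≤ 3 / (n - 3) := by positivity
  have hnn : ∀ p : Prop, ∀ _ : Decidable p, (0 : ℝ) ≤ if p then 1 else 0 := by
    intro p _; split_ifs <;> norm_num
  set S : ℝ := (if l + 0 = j then 1 else 0) + (if l + k = j then 1 else 0) +
        (if l + 0 = j + i then 1 else 0) + (if l + k = j + i then 1 else 0) with hS
  have h1 := hnn (l + 0 = j) inferInstance
  have h2 := hnn (l + k = j) inferInstance
  have h3 := hnn (l + 0 = j + i) inferInstance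
  have h4 := hnn (l + k = j + i) inferInstance
  have hS0 : 0 ≤ S := by positivity
  by_cases hlt : j + i < n ∧ l + k < n
  · obtain ⟨hj, hl⟩ := hlt
    rw [extendRow_of_lt z hj, extendRow_of_lt z hl, extendRow_of_lt z (by omega : j < n),
      extendRow_of_lt z (by omega : l < n)]
    by_cases hd : l ≠ j ∧ l + k ≠ j ∧ l ≠ j + i ∧ l + k ≠ j + i
    · obtain ⟨d1, d2, d3, d4⟩ := hd
      refine (H.abs_integral_four_le_of_distinct hn ?_ ?_ ?_ ?_ ?_ ?_).trans ?_
      any_goals (rw [Ne, Fin.mk.injEq]; omega)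
      have : 12 * M / (n - 3) = 4 * M * (3 / (n - 3)) := by ring
      rw [this]
      exact mul_le_mul_of_nonneg_left (by linarith) (by positivity)
    · have hS1 : 1 ≤ S := by
        have hd' : l + 0 = j ∨ l + k = j ∨ l + 0 = j + i ∨ l + k = j + i := by omega
        rcases hd' with h | h | h | h
        · rw [if_pos h] at h1 hS; linarith
        · rw [if_pos h] at h2 hS; linarith
        · rw [if_pos h] at h3 hS; linarith
        · rw [if_pos h] at h4 hS; linarith
      refine (H.abs_integral_four_le _ _ _ _).trans ?_
      have : 4 * M * 1 ≤ 4 * M * (3 / (n - 3) + S) :=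
        mul_le_mul_of_nonneg_left (by linarith) (by positivity)
      linarith
  · have : ∀ ω, extendRow z j ω * extendRow z (j + i) ω *
        (extendRow z l ω * extendRow z (l + k) ω) = 0 := by
      intro ω
      by_cases hj : j + i < n
      · rw [extendRow_of_le z (by omega : n ≤ l + k)]; ring
      · rw [extendRow_of_le z (by omega : n ≤ j + i)]; ring
    simp only [this, integral_zero, abs_zero]
    positivity

theorem integral_sq_positiveLagSum_le (H : IsCenteredExchangeable P M z) (hn : 4 ≤ n) (B : ℕ) :
    ∫ ω, positiveLagSum n B (fun t => extendRow z t ω) ^ 2 ∂P ≤ 64 * M * B ^ 2 * n := by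
  have hM := H.nonneg (by omega : 0 < n)
  have hn4 : (4 : ℝ) ≤ n := by exact_mod_cast hn
  have hn' : (0 : ℝ) < n - 3 := by linarith
  simp only [positiveLagSum]
  rw [integral_sq_sum _ _ fun p q => H.integrable_extendRow_four _ _ _ _]
  have hinner : ∀ p ∈ Finset.Icc 1 B ×ˢ Finset.range n,
      ∑ q ∈ Finset.Icc 1 B ×ˢ Finset.range n,
        ∫ ω, extendRow z p.2 ω * extendRow z (p.2 + p.1) ω *
          (extendRow z q.2 ω * extendRow z (q.2 + q.1) ω) ∂P ≤ B * (4 * M * 16) := by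
    rintro ⟨i, j⟩ hp
    have hi := (Finset.mem_Icc.1 (Finset.mem_product.1 hp).1).1
    rw [Finset.sum_product]
    calc _ ≤ ∑ _k ∈ Finset.Icc 1 B, 4 * M * 16 := by
          refine Finset.sum_le_sum fun k hk => ?_
          have hk := (Finset.mem_Icc.1 hk).1
          refine (Finset.sum_le_sum fun l _ => (le_abs_self _).trans
            (H.abs_integral_lag_products_le hn hi hk j l)).trans ?_
          rw [← Finset.mul_sum]
          refine mul_le_mul_of_nonneg_left ?_ (by positivity)
          simp only [Finset.sum_add_distrib]
          have s1 := sum_ite_add_eq_le_one n 0 j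
          have s2 := sum_ite_add_eq_le_one n k j
          have s3 := sum_ite_add_eq_le_one n 0 (j + i)
          have s4 := sum_ite_add_eq_le_one n k (j + i)
          -- For `n ≥ 4` one has `3 * n / (n - 3) ≤ 12`. With one from each of the four indicators
          -- this gives the 16.
          have s5 : ∑ _l ∈ Finset.range n, (3 : ℝ) / (n - 3) ≤ 12 := by
            simp only [Finset.sum_const, Finset.card_range, nsmul_eq_mul]
            rw [mul_div_assoc', div_le_iff₀ hn']
            linarith
          linarith
      _ = _ := by simp
  calc _ ≤ ∑ _p ∈ Finset.Icc 1 B ×ˢ Finset.range n, B * (4 * M * 16) := Finset.sum_le_sum hinner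
    _ = _ := by simp; ring

theorem integral_abs_positiveLagSum_le [IsProbabilityMeasure P]
    (H : IsCenteredExchangeable P M z) (hn : 4 ≤ n) (B : ℕ) :
    Integrable (fun ω => 2 / (n : ℝ) * positiveLagSum n B (fun t => extendRow z t ω)) P ∧
    ∫ ω, |2 / (n : ℝ) * positiveLagSum n B (fun t => extendRow z t ω)| ∂P ≤
      (128 * M + 1) * ((B + 1) / √n) := by
  have hM := H.nonneg (by omega : 0 < n)
  have hn' : (0 : ℝ) < n := by exact_mod_cast (by omega : 0 < n)
  have hsn : 0 < √(n : ℝ) := Real.sqrt_pos.2 hn'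
  have hs0 : 0 < √(n : ℝ) / (B + 1) := by positivity
  set s := √(n : ℝ) / (B + 1) with hs
  set R : Ω → ℝ := fun ω => 2 / (n : ℝ) * positiveLagSum n B (fun t => extendRow z t ω) with hR
  have hRm : Measurable R := by
    have := measurable_extendRow H.measurable
    simp only [hR, positiveLagSum]
    fun_prop
  have hR2 : Integrable (fun ω => R ω ^ 2) P := by
    simp only [hR, mul_pow, positiveLagSum]
    refine Integrable.const_mul ?_ _
    simp_rw [sq, Finset.sum_mul_sum]
    exact integrable_finsetSum _ fun p _ => integrable_finsetSum _ fun q _ =>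
      H.integrable_extendRow_four _ _ _ _
  have hpt : ∀ ω, |R ω| ≤ s / 2 * R ω ^ 2 + 1 / (2 * s) := by
    intro ω
    have e1 : s / 2 * R ω ^ 2 + 1 / (2 * s) - |R ω| = (s * |R ω| - 1) ^ 2 / (2 * s) := by
      rw [← sq_abs (R ω)]; field_simp; ring
    have : 0 ≤ (s * |R ω| - 1) ^ 2 / (2 * s) := by positivity
    linarith
  have hdom : Integrable (fun ω => s / 2 * R ω ^ 2 + 1 / (2 * s)) P :=
    (hR2.const_mul _).add (integrable_const _)
  have hRi : Integrable R P := hdom.mono' hRm.aestronglyMeasurable (ae_of_all _ hpt)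
  refine ⟨hRi, ?_⟩
  have hle : ∫ ω, R ω ^ 2 ∂P ≤ (2 / (n : ℝ)) ^ 2 * (64 * M * B ^ 2 * n) := by
    simp only [hR, mul_pow]
    rw [integral_const_mul]
    have := H.integral_sq_positiveLagSum_le hn B
    gcongr
  calc ∫ ω, |R ω| ∂P ≤ ∫ ω, (s / 2 * R ω ^ 2 + 1 / (2 * s)) ∂P := integral_mono hRi.abs hdom hpt
    _ = s / 2 * ∫ ω, R ω ^ 2 ∂P + 1 / (2 * s) := by
        rw [integral_add (hR2.const_mul _) (integrable_const _), integral_const_mul]; simp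
    _ ≤ s / 2 * ((2 / (n : ℝ)) ^ 2 * (64 * M * (B + 1) ^ 2 * n)) + 1 / (2 * s) := by
        gcongr
        refine hle.trans ?_
        gcongr
        linarith
    _ = (128 * M + 1 / 2) * ((B + 1) / √n) := by
        rw [hs]
        have hsq : (n : ℝ) = √n * √n := (Real.mul_self_sqrt hn'.le).symm
        generalize √(n : ℝ) = r at *
        rw [hsq]
        field_simp
        ring
    _ ≤ _ := by gcongr; norm_num

end IsCenteredExchangeable

end PermutedEstimator

/-! ### `L¹` error for the permuted row. -/

section PermutedRow

variable {Ω : Type*} [MeasurableSpace Ω] {P : Measure Ω} {n : ℕ}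

/-- The case of four equal indices in `moment_one_three`, where the gap is `0` and `ρ 0 = 1`. -/
theorem IsMomentMixing.integral_pow_four_le {c R : ℝ} {ρ : ℕ → ℝ} {x : ℕ → Ω → ℝ}
    (H : IsMomentMixing P n c R ρ x) (t : ℕ) : ∫ ω, x t ω ^ 4 ∂P ≤ c := by
  have := (le_abs_self _).trans (H.moment_one_three t t t t le_rfl le_rfl le_rfl)
  simp only [min_self, Nat.sub_self, H.rate_zero, mul_one] at this
  have e : ∀ ω, x t ω ^ 4 = x t ω * x t ω * (x t ω * x t ω) := fun ω => by ring
  simpa only [e] using this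

/-- For the permuted row the estimator is close in `L¹` to the variance of one entry. -/
theorem integral_abs_tauHatSq_perm_sub_le [IsProbabilityMeasure P] {X : Fin n → Ω → ℝ} {c R σ : ℝ} {ρ : ℕ → ℝ}
    (hX : ∀ i, Measurable (X i)) (H : IsMomentMixing P n c R ρ (extendRow X))
    (hstat : IsStrictlyStationaryRow P X)
    (hmean : ∀ i, ∫ ω, X i ω ∂P = 0) (hvar : ∀ i, Var[X i; P] = σ) (hn : 4 ≤ n)
    {perm : Ω → Equiv.Perm (Fin n)} (hperm : Measurable perm)
    (hunif : P.map perm = uniformOn Set.univ) (hind : IndepFun perm (fun ω i => X i ω) P)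
    (b : ℝ) :
    Integrable (fun ω => tauHatSq b fun i => X (perm ω i) ω) P ∧
    ∫ ω, |tauHatSq b (fun i => X (perm ω i) ω) - σ| ∂P ≤
      (12 * c * R + 8 * (c + c ^ 2) * R + 1) * (1 / √n) +
        (128 * (16 * c) + 1) * ((⌊b⌋₊ + 1) / √n) := by
  have hn0 : 0 < n := by omega
  have hY : Measurable fun ω i => X i ω := measurable_pi_iff.2 hX
  have hZ := isCenteredExchangeable_permDeviation (M := c) hperm hY hunif hind
    (fun i => by simpa only [extendRow_coe] using H.integrable_pow i)
    (fun i => by simpa only [extendRow_coe] using H.integral_pow_four_le i)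
  obtain ⟨i2, h2⟩ := hZ.integral_abs_positiveLagSum_le hn ⌊b⌋₊
  have i1 : Integrable (fun ω => tauHatSq 0 fun i => X i ω) P := by
    simp_rw [tauHatSq_extendRow X]
    exact (H.integral_abs_tauHatSq_sub_le hn0 0).1
  have h1 := integral_abs_sampleVariance_sub_le hX H hstat hmean hvar hn0
  have hext : ∀ t ω, extendRow (fun i => permDeviation i) t (perm ω, fun i => X i ω) =
      extendRow (fun i ω => permDeviation i (perm ω, fun i => X i ω)) t ω := fun _ _ => rfl
  have hdec : ∀ ω, tauHatSq b (fun i => X (perm ω i) ω) = tauHatSq 0 (fun i => X i ω) +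
      2 / (n : ℝ) * positiveLagSum n ⌊b⌋₊ (fun t =>
        extendRow (fun i ω => permDeviation i (perm ω, fun i => X i ω)) t ω) := by
    intro ω
    have := tauHatSq_comp_perm b (perm ω) (fun i => X i ω)
    simpa only [hext] using this
  simp_rw [hdec]
  refine ⟨i1.add i2, ?_⟩
  refine le_trans ?_ (add_le_add h1 h2)
  have hadd := integral_add (i1.sub (integrable_const σ)).abs i2.abs
  simp only [Pi.sub_apply] at hadd
  rw [← hadd]
  refine integral_mono ((i1.add i2).sub (integrable_const σ)).abs
    ((i1.sub (integrable_const σ)).abs.add i2.abs) fun ω => ?_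
  rw [add_sub_right_comm]
  exact abs_add_le _ _

end PermutedRow

/-! ### The main theorem. -/

theorem lemma4 {Ω : Type*} [MeasurableSpace Ω] (P : Measure Ω) [IsProbabilityMeasure P]
    (X : (n : ℕ) → Fin n → Ω → ℝ) (δ K C σ τ : ℝ) (b : ℕ → ℝ)
    (hδ : 0 < δ) (hK : 0 < K) (hC : 0 < C) (hσ : 0 < σ) (hτ : 0 < τ)
    (hmeas : ∀ n i, Measurable (X n i))
    (hstat : ∀ n, IsStrictlyStationaryRow P (X n))
    (hmoment : ∀ n i, Integrable (fun ω => |X n i ω| ^ (4 + 2 * δ)) P ∧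
      ∫ ω, |X n i ω| ^ (4 + 2 * δ) ∂P ≤ K)
    (hmean : ∀ n i, ∫ ω, X n i ω ∂P = 0)
    (hmixing : ∀ n, ∑ j ∈ Finset.Icc 1 (n - 1), rowAlpha P (X n) j ^ (δ / (2 + δ)) ≤ C)
    (hvar : ∀ n i, Var[X n i; P] = σ ^ 2)
    (hlongrun : Tendsto (fun n => rowLongRunVariance P (X n)) atTop (𝓝 (τ ^ 2)))
    (hb : Tendsto b atTop atTop)
    (hb_small : b =o[atTop] fun n : ℕ => √(n : ℝ)) :
    TendstoInMeasure P (fun n ω => tauHatSq (b n) fun i => X n i ω) atTop (fun _ => τ ^ 2) ∧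
    ∀ perm : (n : ℕ) → Ω → Equiv.Perm (Fin n),
      (∀ n, Measurable (perm n)) →
      (∀ n, P.map (perm n) = uniformOn Set.univ) →
      (∀ n, IndepFun (perm n) (fun ω i => X n i ω) P) →
      TendstoInMeasure P (fun n ω => tauHatSq (b n) fun i => X n (perm n ω i) ω) atTop
        (fun _ => σ ^ 2) := by
  have hlim := tendsto_floor_add_one_div_sqrt hb hb_small
  have hmix := fun n =>
    isMomentMixing_extendRow (hmeas n) hδ hK.le (hmoment n) (hmean n) (hmixing n)
  refine ⟨?_, fun perm hperm hunif hind => ?_⟩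
  · refine tendstoInMeasure_of_tendsto_integral_abs_sub 1 (fun n hn => ?_)
      (tendsto_integral_abs_tauHatSq_sub hδ hK.le hC.le hmeas hstat hmoment hmean hmixing
        hlongrun hb hb_small)
    simp_rw [tauHatSq_extendRow (X n)]
    exact ((hmix n).integral_abs_tauHatSq_sub_le hn (b n)).1
  · have hbound := fun n (hn : 4 ≤ n) => integral_abs_tauHatSq_perm_sub_le (hmeas n) (hmix n)
      (hstat n) (hmean n) (hvar n) hn (hperm n) (hunif n) (hind n) (b n)
    refine tendstoInMeasure_of_tendsto_integral_abs_sub 4 (fun n hn => (hbound n hn).1) ?_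
    set c := covConst K
    set R := 1 + C
    have hc : 0 ≤ c := (hmix 0).c_nonneg
    have hR : 0 ≤ R := (hmix 0).R_nonneg
    have hlim' := (hlim.const_mul (12 * c * R + 8 * (c + c ^ 2) * R + 1)).add
      (hlim.const_mul (128 * (16 * c) + 1))
    rw [mul_zero, mul_zero, add_zero] at hlim'
    refine squeeze_zero' (Eventually.of_forall fun n => integral_nonneg fun ω => abs_nonneg _) ?_
      hlim'
    filter_upwards [eventually_ge_atTop 4] with n hn
    refine (hbound n hn).2.trans ?_
    -- The sample-variance error `1 / √n` is enlarged to `(⌊b n⌋₊ + 1) / √n`, so a single limit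
    -- serves both terms.
    gcongr
    simp
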